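/- For a connected simple graph $H$ on a finite vertex set with at least two vertices, let $\mathcal K(H)$ denote Kemeny's constant of the simple random walk on $H$ (transition matrix $\Delta^{-1}A$, where $A$ is the adjacency matrix and $\Delta$ the diagonal matrix of degrees): $\mathcal K(H)=\sum_{k\ne j} m_{j,k}w_k$, where $w$ is the stationary distribution, $m_{j,k}$ is the mean first passage time from $j$ to $k$, and the value does not depend on the initial vertex $j$. Let $n\ge 4$, let $T$ be a tree on $n$ vertices, let $u\neq v$ be two non-adjacent vertices of $T$, and let $G$ be the graph obtained from $T$ by adding the edge $uv$. Then $$\mathcal K(G)-\mathcal K(T)\;\le\;\frac{4n^3-32n^2+85n-81}{6n(n-1)}.$$ Equality holds if and only if $T$ is (up to isomorphism) the tree formed from the path $P_{n-1}$ on $n-1$ vertices by adding a new pendent vertex (vertex of degree one) adjacent to a next-to-pendent vertex of the path (a vertex adjacent to a pendent vertex), and $u,v$ are twin pendent vertices of $T$, i.e. two distinct pendent vertices with a common neighbour. Moreover, the right-hand side is asymptotic to $\frac{2n}{3}$ as $n\to\infty$. -/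

import Mathlib

namespace KemenyTree

noncomputable section

/-! Markov chains on a finite state space and Kemeny's constant -/

section MarkovChain

variable {V : Type*} [Fintype V]

/-- `noHit P k t j` is the probability that the Markov chain with transition matrix `P`, started
at `j`, does not visit `k` during the steps `1, …, t`, i.e. `ℙ_j (F_k > t)` where
`F_k = min {s ≥ 1 | X_s = k}` is the first passage time to `k`. (First step decomposition.) -/
def noHit (P : Matrix V V ℝ) (k : V) : ℕ → V → ℝ
  | 0, _ => 1
  | t + 1, j => open Classical in ∑ l with l ≠ k, P j l * noHit P k t l

/-- The mean first passage time `m_{j,k} = 𝔼_j [F_k] = ∑_{t ≥ 0} ℙ_j (F_k > t)`. -/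
def meanFirstPassage (P : Matrix V V ℝ) (j k : V) : ℝ :=
  ∑' t : ℕ, noHit P k t j

/-- `w` is a stationary distribution of the chain with transition matrix `P`. -/
def IsStationary (P : Matrix V V ℝ) (w : V → ℝ) : Prop :=
  (∀ k, 0 ≤ w k) ∧ ∑ k, w k = 1 ∧ Matrix.vecMul w P = w

/-- The sum `∑_{k ≠ j} m_{j,k} w_k`; for the stationary distribution `w` of an irreducible chain,
this is Kemeny's constant (the value computed from the initial state `j`). -/
def kemenySum (P : Matrix V V ℝ) (w : V → ℝ) (j : V) : ℝ :=
  open Classical in ∑ k with k ≠ j, meanFirstPassage P j k * w k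

end MarkovChain

/-! The random walk on a graph -/

section RandomWalk

variable {V : Type*} [Fintype V]

/-- The transition matrix `Δ⁻¹ A` of the random walk on `G`, where `Δ` is the diagonal matrix of
vertex degrees and `A` the adjacency matrix. -/
def walkMatrix (G : SimpleGraph V) : Matrix V V ℝ :=
  open Classical in
  Matrix.diagonal (fun v => ((G.degree v : ℝ))⁻¹) * G.adjMatrix ℝ

/-- The stationary distribution of the random walk on `G`: the vector of vertex degrees, divided
by their sum. See `isStationary_iff`. -/
def stationary (G : SimpleGraph V) (k : V) : ℝ :=
  open Classical in (G.degree k : ℝ) / ∑ l, (G.degree l : ℝ)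

/-- Kemeny's constant `𝒦(G)` of the random walk on `G`, computed from the initial vertex `j`, on
which it does not depend when `G` is connected. -/
def kemeny (G : SimpleGraph V) (j : V) : ℝ :=
  kemenySum (walkMatrix G) (stationary G) j

theorem walkMatrix_apply (G : SimpleGraph V)
    [DecidableRel G.Adj] (j k : V) :
    walkMatrix G j k = if G.Adj j k then ((G.degree j : ℝ))⁻¹ else 0 := by
  classical
  simp only [walkMatrix, Matrix.diagonal_mul, SimpleGraph.adjMatrix_apply, mul_ite, mul_one,
    mul_zero]
  congr!

/-- On a connected graph with at least two vertices, `stationary G` is the one and only stationary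
distribution of the random walk. -/
theorem isStationary_iff [Nontrivial V] (G : SimpleGraph V) (hG : G.Connected) (w : V → ℝ) :
    IsStationary (walkMatrix G) w ↔ w = stationary G := by
  classical
  have hd : ∀ v, (0 : ℝ) < G.degree v := fun v => by
    exact_mod_cast hG.preconnected.degree_pos_of_nontrivial v
  have hS : (0 : ℝ) < ∑ l, (G.degree l : ℝ) :=
    Finset.sum_pos (fun v _ => hd v) Finset.univ_nonempty
  have hst : ∀ k, stationary G k = (G.degree k : ℝ) / ∑ l, (G.degree l : ℝ) := by
    intro k; simp only [stationary]
  have hmul : ∀ (w : V → ℝ) (k : V), Matrix.vecMul w (walkMatrix G) k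
      = ∑ j, if G.Adj k j then w j / G.degree j else 0 := by
    intro w k
    simp only [Matrix.vecMul, dotProduct, walkMatrix_apply]
    refine Finset.sum_congr rfl fun j _ => ?_
    simp [G.adj_comm j k, div_eq_mul_inv]
  constructor
  · rintro ⟨-, h1, h2⟩
    have hlap : (G.lapMatrix ℝ).mulVec (fun v => w v / G.degree v) = 0 := by
      funext k
      have := congrFun h2 k
      rw [hmul] at this
      rw [SimpleGraph.lapMatrix_mulVec_apply, mul_div_cancel₀ _ (hd k).ne']
      rw [← Finset.sum_filter] at this
      rw [← SimpleGraph.neighborFinset_eq_filter] at this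
      simp [this]
    rw [SimpleGraph.lapMatrix_mulVec_eq_zero_iff_forall_reachable] at hlap
    funext k
    have hw : ∀ v, w v = w k / G.degree k * G.degree v := fun v => by
      have := hlap v k (hG.preconnected v k)
      rw [← this, div_mul_cancel₀ _ (hd v).ne']
    have : (1 : ℝ) = w k / G.degree k * ∑ v, (G.degree v : ℝ) := by
      rw [← h1, Finset.mul_sum]
      exact Finset.sum_congr rfl fun v _ => hw v
    rw [hst, eq_div_iff hS.ne']
    have hk := (hd k).ne'
    field_simp at this
    linarith
  · rintro rfl
    refine ⟨fun k => ?_, ?_, ?_⟩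
    · rw [hst]; positivity
    · simp only [hst]
      rw [← Finset.sum_div, div_self hS.ne']
    · funext k
      rw [hmul, hst]
      have : ∀ j, stationary G j / G.degree j = 1 / ∑ l, (G.degree l : ℝ) := fun j => by
        rw [hst]
        have := (hd j).ne'
        field_simp
      simp only [this]
      rw [← Finset.sum_filter, ← SimpleGraph.neighborFinset_eq_filter]
      simp [div_eq_mul_inv]

/-- On a connected graph with at least two vertices the series that defines the mean first passage
times converges. -/
theorem summable_noHit [Nontrivial V] (G : SimpleGraph V) (hG : G.Connected) (j k : V) :
    Summable (fun t => noHit (walkMatrix G) k t j) := by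
  classical
  have hdn : ∀ v, 0 < G.degree v := fun v => hG.preconnected.degree_pos_of_nontrivial v
  have hd : ∀ v, (0 : ℝ) < G.degree v := fun v => by exact_mod_cast hdn v
  have hp0 : ∀ a b, 0 ≤ walkMatrix G a b := fun a b => by
    rw [walkMatrix_apply]; split_ifs <;> positivity
  have hp1 : ∀ a, ∑ b, walkMatrix G a b = 1 := fun a => by
    simp only [walkMatrix_apply]
    rw [← Finset.sum_filter, ← SimpleGraph.neighborFinset_eq_filter]
    simp [(hd a).ne']
  have hn0 : ∀ t a, 0 ≤ noHit (walkMatrix G) k t a := by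
    intro t
    induction t with
    | zero => intro a; simp [noHit]
    | succ t ih =>
      intro a
      simp only [noHit]
      exact Finset.sum_nonneg fun l _ => mul_nonneg (hp0 a l) (ih l)
  -- a Lyapunov function bounds all partial sums
  suffices h : ∃ W : V → ℝ, (∀ a, 0 ≤ W a) ∧
      ∀ a, 1 + ∑ l with l ≠ k, walkMatrix G a l * W l ≤ W a by
    obtain ⟨W, hW0, hW⟩ := h
    have key : ∀ N a, ∑ t ∈ Finset.range N, noHit (walkMatrix G) k t a ≤ W a := by
      intro N
      induction N with
      | zero => intro a; simpa using hW0 a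
      | succ N ih =>
        intro a
        rw [Finset.sum_range_succ']
        refine le_trans ?_ (hW a)
        simp only [noHit]
        rw [Finset.sum_comm, add_comm]
        simp only [← Finset.mul_sum]
        have hle : ∑ l with l ≠ k, walkMatrix G a l *
              ∑ t ∈ Finset.range N, noHit (walkMatrix G) k t l
            ≤ ∑ l with l ≠ k, walkMatrix G a l * W l :=
          Finset.sum_le_sum fun l _ => mul_le_mul_of_nonneg_left (ih l) (hp0 a l)
        convert add_le_add_right hle 1
    exact summable_of_sum_range_le (fun t => hn0 t j) (fun N => key N j)
  obtain ⟨D, hD⟩ : ∃ D : ℝ, D = Fintype.card V := ⟨_, rfl⟩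
  have hD1 : 1 ≤ D := by
    rw [hD]; exact_mod_cast Fintype.card_pos
  obtain ⟨r, hr⟩ : ∃ r : ℝ, r = 1 / (2 * D) := ⟨_, rfl⟩
  have hr0 : 0 < r := by rw [hr]; positivity
  have hr1 : r ≤ 1 := by
    rw [hr, div_le_one (by positivity)]; linarith
  obtain ⟨U, hU⟩ : ∃ U : ℕ → ℝ, U = fun a => ∑ i ∈ Finset.range a, r ^ i := ⟨_, rfl⟩
  have hU0 : ∀ a, 0 ≤ U a := fun a => by
    rw [hU]; exact Finset.sum_nonneg fun i _ => by positivity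
  have hUs : ∀ a, U (a + 1) = U a + r ^ a := fun a => by
    rw [hU]; exact Finset.sum_range_succ _ _
  have hUmono : Monotone U := monotone_nat_of_le_succ fun a => by
    rw [hUs]; have := pow_pos hr0 a; linarith
  obtain ⟨M, hM⟩ : ∃ M : ℕ, ∀ v, G.dist v k ≤ M :=
    ⟨∑ v, G.dist v k, fun v =>
      Finset.single_le_sum (f := fun v => G.dist v k) (fun _ _ => Nat.zero_le _)
        (Finset.mem_univ v)⟩
  have hrM : 0 < r ^ M := pow_pos hr0 M
  have drift : ∀ a, a ≠ k →
      ∑ l, walkMatrix G a l * U (G.dist l k) ≤ U (G.dist a k) - r ^ M := by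
    intro a hak
    obtain ⟨l0, hl0, hl0d⟩ : ∃ l0, G.Adj a l0 ∧ G.dist a k = G.dist l0 k + 1 := by
      obtain ⟨p, hp⟩ := hG.exists_walk_length_eq_dist a k
      cases p with
      | nil => exact absurd rfl hak
      | @cons _ b _ h q =>
        refine ⟨b, h, ?_⟩
        have h1 : G.dist b k ≤ q.length := SimpleGraph.dist_le q
        have h2 : G.dist a k ≤ G.dist a b + G.dist b k := hG.dist_triangle
        have h3 : G.dist a b = 1 := SimpleGraph.dist_eq_one_iff_adj.mpr h
        simp only [SimpleGraph.Walk.length_cons] at hp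
        omega
    obtain ⟨m, hm⟩ : ∃ m, m = G.dist l0 k := ⟨_, rfl⟩
    rw [← hm] at hl0d
    have hterm : ∀ l, walkMatrix G a l * U (G.dist l k) ≤
        walkMatrix G a l * (U (m + 1) + r ^ (m + 1))
          - (if l = l0 then walkMatrix G a l0 * r ^ m else 0) := by
      intro l
      by_cases hl : l = l0
      · subst hl
        rw [if_pos rfl, ← hm, ← mul_sub]
        refine mul_le_mul_of_nonneg_left ?_ (hp0 _ _)
        rw [hUs]
        have := pow_pos hr0 (m + 1)
        linarith
      · rw [if_neg hl, sub_zero]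
        by_cases hal : G.Adj a l
        · refine mul_le_mul_of_nonneg_left ?_ (hp0 _ _)
          rw [← hUs]
          apply hUmono
          have h2 : G.dist l k ≤ G.dist l a + G.dist a k := hG.dist_triangle
          have h3 : G.dist l a = 1 := SimpleGraph.dist_eq_one_iff_adj.mpr hal.symm
          omega
        · simp [walkMatrix_apply, hal]
    refine (Finset.sum_le_sum fun l _ => hterm l).trans ?_
    rw [Finset.sum_sub_distrib, ← Finset.sum_mul, hp1, one_mul, Finset.sum_ite_eq',
      if_pos (Finset.mem_univ _), hl0d]
    have hpl : 2 * r ≤ walkMatrix G a l0 := by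
      rw [walkMatrix_apply, if_pos hl0, hr]
      have hle : (G.degree a : ℝ) ≤ D := by
        rw [hD]; exact_mod_cast (G.degree_lt_card_verts a).le
      have h1 : 2 * (1 / (2 * D)) = D⁻¹ := by field_simp
      rw [h1]
      exact inv_anti₀ (hd a) hle
    have h1 : r ^ M ≤ r ^ (m + 1) :=
      pow_le_pow_of_le_one hr0.le hr1 (hl0d ▸ hM a)
    have h2 : 2 * r * r ^ m ≤ walkMatrix G a l0 * r ^ m :=
      mul_le_mul_of_nonneg_right hpl (pow_pos hr0 m).le
    have h3 : r ^ (m + 1) = r * r ^ m := pow_succ' r m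
    linarith
  have hdrop : ∀ a, ∑ l with l ≠ k, walkMatrix G a l * (U (G.dist l k) / r ^ M)
      = (∑ l, walkMatrix G a l * U (G.dist l k)) / r ^ M := by
    intro a
    rw [Finset.sum_filter, Finset.sum_div]
    refine Finset.sum_congr rfl fun l _ => ?_
    by_cases hl : l = k
    · subst hl
      simp [hU]
    · rw [if_pos hl, mul_div_assoc]
  refine ⟨fun a => if a = k then 1 + U M / r ^ M else U (G.dist a k) / r ^ M, fun a => ?_,
    fun a => ?_⟩
  · have h1 := hU0 M
    have h2 := hU0 (G.dist a k)
    dsimp only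
    split_ifs <;> positivity
  · have hcongr : ∑ l with l ≠ k, walkMatrix G a l *
          (if l = k then 1 + U M / r ^ M else U (G.dist l k) / r ^ M)
        = ∑ l with l ≠ k, walkMatrix G a l * (U (G.dist l k) / r ^ M) := by
      refine Finset.sum_congr rfl fun l hl => ?_
      rw [if_neg (Finset.mem_filter.mp hl).2]
    rw [hcongr, hdrop]
    beta_reduce
    by_cases ha : a = k
    · rw [if_pos ha]
      have : ∑ l, walkMatrix G a l * U (G.dist l k) ≤ U M := by
        calc _ ≤ ∑ l, walkMatrix G a l * U M :=
              Finset.sum_le_sum fun l _ => mul_le_mul_of_nonneg_left (hUmono (hM l)) (hp0 a l)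
          _ = U M := by rw [← Finset.sum_mul, hp1, one_mul]
      gcongr
    · rw [if_neg ha]
      have := drift a ha
      rw [le_div_iff₀ hrM, add_mul, div_mul_cancel₀ _ hrM.ne']
      linarith

end RandomWalk

/-! Pendent vertices -/

section Pendent

/-- A pendent vertex: a vertex with exactly one neighbour. -/
def IsPendent {V : Type*} (G : SimpleGraph V) (x : V) : Prop :=
  ∃! y, G.Adj x y

/-- A next-to-pendent vertex: a vertex adjacent to a pendent vertex. -/
def IsNextToPendent {V : Type*} (G : SimpleGraph V) (y : V) : Prop :=
  ∃ x, IsPendent G x ∧ G.Adj x y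

/-- Twin pendent vertices: two distinct pendent vertices with a common neighbour. -/
def AreTwinPendent {V : Type*} (G : SimpleGraph V) (x y : V) : Prop :=
  x ≠ y ∧ IsPendent G x ∧ IsPendent G y ∧ ∃ z, G.Adj x z ∧ G.Adj y z

/-- The graph formed from `H` by adding a new pendent vertex `none` adjacent to the vertex `a`. -/
def addPendent {W : Type*} (H : SimpleGraph W) (a : W) : SimpleGraph (Option W) :=
  H.map some ⊔ SimpleGraph.edge none (some a)

end Pendent

end

end KemenyTree

/-! Let `n` be the number of vertices, `D` the distance of `u` and `v` in `T`, and `φ` the potential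
of a unit flow between `u` and `v`. Kemeny's constant equals `∑ d_x d_y R_xy / (2 ∑ d_x)`, with `R`
the effective resistance (`IsResistance.kemeny_eq`). In a tree `R` is the distance, and a new edge
subtracts the rank one correction `(φ_x - φ_y)² / (1 + D)` (`IsResistance.sup_edge`). Hence the
change of the constant depends only on `n`, `D`, the sums of distances and the energy of `φ`
(`kemeny_sub_kemeny`).

The energy is bounded below by the path from `u` to `v` alone: its vertices have degree at least two
in the new graph, and `φ` is antisymmetric along it (`le_energy`).

For the distances, let `ρ_x` be the height of `x` above this path. Then `d(x,y)` is `|ρ_x - ρ_y| +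
|φ_x - φ_y|` plus a slack, nonnegative by the triangle inequality. Since `|a - b| = a + b - 2 min a
b`, the distance part of the change is governed by the sum of `min ρ_x ρ_y` over pairs of distinct
vertices other than `u`, `v` (`transmission_excess_eq`). Heights have no gaps, so this sum is
largest when they are `0, …, n - 3` (`sum_min_le`).

The bound minus the actual change is therefore a combination of five nonnegative terms
(`bound_sub_kemeny_sub`), one of them a polynomial in `D` that vanishes only at `D = 2`. If `D = 2`,
`φ` is constant off `{u, v}` and the slack is zero, then the remaining vertices form a path ordered
by height, with `u` and `v` both hanging from its bottom. `IsForkLabel` encodes this shape, and on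
it all five terms vanish. -/

namespace KemenyTree

open Finset

/-! ### Laplacian, effective resistance and Kemeny's constant. -/

section Resistance

variable {V : Type*} [Fintype V]

/-- The degree of a vertex, as a real number. -/
noncomputable def deg (G : SimpleGraph V) (x : V) : ℝ :=
  open Classical in (G.degree x : ℝ)

/-- The graph Laplacian applied to a function. -/
noncomputable def lap (G : SimpleGraph V) (f : V → ℝ) (x : V) : ℝ :=
  open Classical in ∑ y, if G.Adj x y then f x - f y else 0

theorem lap_eq_lapMatrix_mulVec [DecidableEq V] (G : SimpleGraph V) [DecidableRel G.Adj]
    (f : V → ℝ) : lap G f = (G.lapMatrix ℝ).mulVec f := by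
  funext x
  have h : lap G f x = ∑ y, if G.Adj x y then f x - f y else 0 := by
    unfold lap; congr!
  rw [SimpleGraph.lapMatrix_mulVec_apply, h, ← Finset.sum_filter,
    ← SimpleGraph.neighborFinset_eq_filter, Finset.sum_sub_distrib, Finset.sum_const,
    SimpleGraph.card_neighborFinset_eq_degree, nsmul_eq_mul]

/-- Summation by parts; every edge appears twice in the double sum, once from each end. -/
theorem sum_mul_lap (G : SimpleGraph V) (f g : V → ℝ) :
    ∑ x, f x * lap G g x
      = (open Classical in ∑ x, ∑ y, if G.Adj x y then (f x - f y) * (g x - g y) else 0) / 2 := by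
  classical
  have h1 : ∑ x, f x * lap G g x = ∑ x, ∑ y, if G.Adj x y then f x * (g x - g y) else 0 := by
    refine sum_congr rfl fun x _ => ?_
    rw [lap, mul_sum]
    refine sum_congr rfl fun y _ => ?_
    split_ifs <;> simp
  have h2 : ∑ x, f x * lap G g x = ∑ x, ∑ y, if G.Adj x y then f y * (g y - g x) else 0 := by
    rw [h1, sum_comm]
    refine sum_congr rfl fun x _ => sum_congr rfl fun y _ => ?_
    simp only [G.adj_comm]
  rw [eq_div_iff two_ne_zero, mul_two]
  nth_rw 1 [h1]
  rw [h2, ← sum_add_distrib]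
  refine sum_congr rfl fun x _ => ?_
  rw [← sum_add_distrib]
  refine sum_congr rfl fun y _ => ?_
  split_ifs <;> ring

theorem sum_lap (G : SimpleGraph V) (f : V → ℝ) : ∑ x, lap G f x = 0 := by
  have := sum_mul_lap G (fun _ => 1) f
  simpa using this

theorem eq_of_lap_eq_zero {G : SimpleGraph V} (hG : G.Connected) {f : V → ℝ}
    (hf : ∀ x, lap G f x = 0) (x y : V) : f x = f y := by
  classical
  have h : (G.lapMatrix ℝ).mulVec f = 0 := by
    rw [← lap_eq_lapMatrix_mulVec]; funext x; exact hf x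
  rw [SimpleGraph.lapMatrix_mulVec_eq_zero_iff_forall_reachable] at h
  exact h x y (hG.preconnected x y)

theorem lap_linear (G : SimpleGraph V) (a b : ℝ) (f g : V → ℝ) (x : V) :
    lap G (fun y => a * f y + b * g y) x = a * lap G f x + b * lap G g x := by
  simp only [lap, mul_sum, ← sum_add_distrib]
  refine sum_congr rfl fun y _ => ?_
  split_ifs <;> ring

theorem lap_sum {ι : Type*} (G : SimpleGraph V) (s : Finset ι) (f : ι → V → ℝ) (x : V) :
    lap G (fun y => ∑ i ∈ s, f i y) x = ∑ i ∈ s, lap G (f i) x := by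
  simp only [lap]
  rw [sum_comm]
  refine sum_congr rfl fun y _ => ?_
  split_ifs
  · rw [sum_sub_distrib]
  · simp

theorem lap_eq_deg_mul_sub (G : SimpleGraph V) (f : V → ℝ) (x : V) :
    lap G f x = deg G x * f x - open Classical in ∑ y, if G.Adj x y then f y else 0 := by
  classical
  rw [lap_eq_lapMatrix_mulVec, SimpleGraph.lapMatrix_mulVec_apply, deg, ← Finset.sum_filter]
  congr 2
  ext; simp

theorem deg_pos [Nontrivial V] {G : SimpleGraph V} (hG : G.Connected) (x : V) : 0 < deg G x := by
  classical
  have := hG.preconnected.degree_pos_of_nontrivial x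
  rw [deg]; exact_mod_cast this

/-- The mean first passage time, as a function of the initial vertex, first step equation. -/
theorem meanFirstPassage_eq [Nontrivial V] {G : SimpleGraph V} (hG : G.Connected) (j k : V) :
    meanFirstPassage (walkMatrix G) j k
      = 1 + open Classical in
          ∑ l with l ≠ k, walkMatrix G j l * meanFirstPassage (walkMatrix G) l k := by
  classical
  rw [meanFirstPassage, (summable_noHit G hG j k).tsum_eq_zero_add]
  simp only [noHit]
  rw [Summable.tsum_finsetSum fun l _ => (summable_noHit G hG l k).mul_left _]
  simp only [tsum_mul_left]
  congr!

/-- A symmetric function with zero diagonal satisfying the Laplace equations of the effective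
resistance between the vertices of `G`. -/
structure IsResistance (G : SimpleGraph V) (R : V → V → ℝ) : Prop where
  self : ∀ x, R x x = 0
  symm : ∀ x y, R x y = R y x
  -- With `M` the pseudoinverse of the Laplacian, `R x y = M x x + M y y - 2 * M x y`, so apart from
  -- the point mass at `y` the Laplacian of `R · y` does not depend on `y`. The value of `c` is
  -- never needed.
  lap_eq : ∃ c : V → ℝ, ∀ x y,
    lap G (fun z => R z y) x = c x - open Classical in if x = y then 2 else 0

theorem IsResistance.meanFirstPassage_eq [Nontrivial V] {G : SimpleGraph V} (hG : G.Connected)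
    {R : V → V → ℝ} (hR : IsResistance G R) {j k : V} (hjk : j ≠ k) :
    meanFirstPassage (walkMatrix G) j k
      = 1 / 2 * ∑ y, deg G y * (R j k + R k y - R j y) := by
  classical
  obtain ⟨c, hc⟩ := hR.lap_eq
  obtain ⟨H, hH⟩ : ∃ H : V → ℝ, H = fun z => 1 / 2 * ∑ y, deg G y * (R z k + R k y - R z y) :=
    ⟨_, rfl⟩
  -- The value at `k` is reset to `0`, because the first passage time from `k` to itself is a return
  -- time. Then `H` and `m` agree at `k` and have the same Laplacian elsewhere.
  obtain ⟨m, hm⟩ : ∃ m : V → ℝ, m = fun z => if z = k then 0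
    else meanFirstPassage (walkMatrix G) z k := ⟨_, rfl⟩
  have hHk : H k = 0 := by simp [hH, hR.self]
  have hmk : m k = 0 := by simp [hm]
  have hlapH : ∀ x, x ≠ k → lap G H x = deg G x := by
    intro x hx
    have h1 : H = fun z => (1 / 2 * ∑ y, deg G y) * R z k +
        1 * ((1 / 2) * (∑ y, deg G y * R k y) + (-1 / 2) * ∑ y, deg G y * R z y) := by
      funext z
      simp only [hH, mul_sub, mul_add, sum_sub_distrib, sum_add_distrib, ← sum_mul]
      ring
    have h2 : ∀ y, lap G (fun z => deg G y * R z y) x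
        = deg G y * (c x - if x = y then 2 else 0) := fun y => by
      have := lap_linear G (deg G y) 0 (fun z => R z y) (fun _ => 0) x
      simpa [hc] using this
    have h3 : lap G (fun _ => ∑ y, deg G y * R k y) x = 0 := by simp [lap]
    have h4 : lap G (fun z => ∑ y, deg G y * R z y) x
        = ∑ y, lap G (fun z => deg G y * R z y) x := lap_sum G univ (fun y z => deg G y * R z y) x
    rw [h1, lap_linear, lap_linear, hc, h3, h4]
    simp only [h2, if_neg hx, mul_sub, sum_sub_distrib, ← sum_mul]
    simp
    ring
  have hlapm : ∀ x, x ≠ k → lap G m x = deg G x := by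
    intro x hx
    have hd := (deg_pos hG x).ne'
    rw [lap_eq_deg_mul_sub]
    have h1 : m x = meanFirstPassage (walkMatrix G) x k := by simp [hm, hx]
    have h2 : (∑ l with l ≠ k, walkMatrix G x l * meanFirstPassage (walkMatrix G) l k)
        = (deg G x)⁻¹ * ∑ y, if G.Adj x y then m y else 0 := by
      rw [sum_filter, mul_sum]
      refine sum_congr rfl fun y _ => ?_
      rw [walkMatrix_apply, hm, deg]
      by_cases hy : y = k <;> by_cases hxy : G.Adj x y <;> simp [hy, hxy]
    rw [h1, KemenyTree.meanFirstPassage_eq hG, mul_add, mul_one]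
    have h3 := congrArg (fun t => deg G x * t) h2
    simp only [mul_inv_cancel_left₀ hd] at h3
    rw [← h3]
    simp
  have hlap0 : ∀ x, lap G (fun z => 1 * H z + (-1) * m z) x = 0 := by
    have h1 : ∀ x, x ≠ k → lap G (fun z => 1 * H z + (-1) * m z) x = 0 := by
      intro x hx
      rw [lap_linear, hlapH x hx, hlapm x hx]; ring
    intro x
    -- A Laplacian sums to zero, so vanishing off `k` forces vanishing at `k`.
    by_cases hx : x = k
    · have h2 := sum_lap G (fun z => 1 * H z + (-1) * m z)
      rw [Finset.sum_eq_single k (fun b _ hb => h1 b hb) (by simp)] at h2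
      rw [hx, h2]
    · exact h1 x hx
  have h := eq_of_lap_eq_zero hG hlap0 j k
  simp only [hHk, hmk] at h
  have h1 : m j = meanFirstPassage (walkMatrix G) j k := by simp [hm, hjk]
  rw [← h1]
  have h2 : H j = 1 / 2 * ∑ y, deg G y * (R j k + R k y - R j y) := by rw [hH]
  linarith

/-- Kemeny's constant in terms of degrees and resistances. -/
theorem IsResistance.kemeny_eq [Nontrivial V] {G : SimpleGraph V} (hG : G.Connected)
    {R : V → V → ℝ} (hR : IsResistance G R) (j : V) :
    kemeny G j = (∑ x, ∑ y, deg G x * deg G y * R x y) / (2 * ∑ x, deg G x) := by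
  classical
  have hS : (0 : ℝ) < ∑ x, deg G x := sum_pos (fun x _ => deg_pos hG x) univ_nonempty
  obtain ⟨s, hs⟩ : ∃ s, s = ∑ x, deg G x := ⟨_, rfl⟩
  rw [← hs] at hS ⊢
  have h1 : kemeny G j = ∑ k, (1 / 2 * ∑ y, deg G y * (R j k + R k y - R j y)) * (deg G k / s) := by
    rw [kemeny, kemenySum, sum_filter]
    refine sum_congr rfl fun k _ => ?_
    have hw : stationary G k = deg G k / s := by rw [hs]; rfl
    by_cases hk : k = j
    · subst hk; simp [hR.self]
    · rw [if_pos hk, hR.meanFirstPassage_eq hG (Ne.symm hk), hw]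
  -- Summed over `k`, the first and third terms both give half of `∑ y, deg G y * R j y` and cancel;
  -- this removes the initial vertex `j`.
  have h2 : ∀ k, (1 / 2 * ∑ y, deg G y * (R j k + R k y - R j y)) * (deg G k / s)
      = 1 / 2 * (deg G k * R j k) + (∑ y, deg G k * deg G y * R k y) / (2 * s)
        - (deg G k) * (∑ y, deg G y * R j y) / (2 * s) := by
    intro k
    have e1 : ∑ y, deg G y * (R j k + R k y - R j y)
        = s * R j k + ∑ y, deg G y * R k y - ∑ y, deg G y * R j y := by
      simp only [mul_sub, mul_add, sum_sub_distrib, sum_add_distrib, ← sum_mul, hs]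
    have e2 : ∑ y, deg G k * deg G y * R k y = deg G k * ∑ y, deg G y * R k y := by
      rw [mul_sum]; exact sum_congr rfl fun y _ => by ring
    rw [e1, e2]
    field_simp
  rw [h1]
  simp only [h2]
  rw [sum_sub_distrib, sum_add_distrib, ← mul_sum, ← sum_div, ← sum_div, ← sum_mul, ← hs]
  field_simp
  ring

end Resistance

/-! ### Distances in a tree are resistances. -/

section TreeDistance

variable {V : Type*}

/-- A neighbour closer to `y` starts a geodesic from `x` to `y`, and a tree has only one path
between two vertices. -/
theorem existsUnique_adj_dist {T : SimpleGraph V} (hT : T.IsTree) {x y : V} (hxy : x ≠ y) :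
    ∃! z, T.Adj x z ∧ T.dist x y = T.dist z y + 1 := by
  have key : ∀ z, T.Adj x z → T.dist x y = T.dist z y + 1 →
      ∃ p : T.Walk x y, p.IsPath ∧ p.snd = z := by
    intro z hz hd
    obtain ⟨q, hq⟩ := hT.connected.exists_walk_length_eq_dist z y
    refine ⟨SimpleGraph.Walk.cons hz q, ?_, by simp⟩
    apply SimpleGraph.Walk.isPath_of_length_eq_dist
    rw [SimpleGraph.Walk.length_cons, hq, hd]
  obtain ⟨p, hp⟩ := hT.connected.exists_walk_length_eq_dist x y
  cases p with
  | nil => exact absurd rfl hxy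
  | @cons _ z _ h q =>
    have hz : T.dist x y = T.dist z y + 1 := by
      have h1 : T.dist z y ≤ q.length := SimpleGraph.dist_le q
      have h2 : T.dist x y ≤ T.dist x z + T.dist z y := hT.connected.dist_triangle
      have h3 : T.dist x z = 1 := SimpleGraph.dist_eq_one_iff_adj.mpr h
      simp only [SimpleGraph.Walk.length_cons] at hp
      omega
    refine ⟨z, ⟨h, hz⟩, fun w hw => ?_⟩
    obtain ⟨p₁, hp₁, rfl⟩ := key z h hz
    obtain ⟨p₂, hp₂, rfl⟩ := key w hw.1 hw.2
    have := hT.isAcyclic.subsingleton_path x y |>.elim ⟨p₁, hp₁⟩ ⟨p₂, hp₂⟩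
    rw [Subtype.mk.inj this]

variable [Fintype V]

theorem deg_eq_sum (G : SimpleGraph V) (x : V) :
    deg G x = open Classical in ∑ y, if G.Adj x y then (1 : ℝ) else 0 := by
  classical
  rw [deg, ← Finset.sum_filter, ← SimpleGraph.neighborFinset_eq_filter]
  simp

/-- For `x ≠ y` one neighbour of `x` is nearer to `y` and all others are farther, which gives `1 -
(deg T x - 1)`; at `x = y` all are farther. -/
theorem lap_dist {T : SimpleGraph V} (hT : T.IsTree) (x y : V) :
    lap T (fun z => (T.dist z y : ℝ)) x
      = (2 - deg T x) - open Classical in if x = y then 2 else 0 := by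
  classical
  rw [deg_eq_sum]
  by_cases hxy : x = y
  · subst hxy
    rw [if_pos rfl, sub_sub_cancel_left, lap, ← sum_neg_distrib]
    refine sum_congr rfl fun z _ => ?_
    by_cases hz : T.Adj x z
    · have : T.dist z x = 1 := SimpleGraph.dist_eq_one_iff_adj.mpr hz.symm
      simp [hz, this]
    · simp [hz]
  · obtain ⟨w, ⟨hw, hwd⟩, huniq⟩ := existsUnique_adj_dist hT hxy
    have h1 : ∀ z, (if T.Adj x z then (T.dist x y : ℝ) - (T.dist z y : ℝ) else 0)
        = (if z = w then 2 else 0) - if T.Adj x z then 1 else 0 := by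
      intro z
      by_cases hz : T.Adj x z
      · rw [if_pos hz, if_pos hz]
        by_cases hzw : z = w
        · subst hzw
          rw [if_pos rfl, hwd]; push_cast; ring
        · rw [if_neg hzw]
          rcases hT.dist_eq_dist_add_one_of_adj y hz with h | h
          · rw [SimpleGraph.dist_comm, T.dist_comm (u := y)] at h
            exact absurd (huniq z ⟨hz, h⟩) hzw
          · rw [SimpleGraph.dist_comm, T.dist_comm (u := y)] at h
            rw [h]; push_cast; ring
      · have hzw : z ≠ w := fun h => hz (h ▸ hw)
        simp [hz, hzw]
    rw [if_neg hxy, lap]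
    simp only [h1]
    rw [sum_sub_distrib]
    simp

theorem isResistance_dist {T : SimpleGraph V} (hT : T.IsTree) :
    IsResistance T (fun x y => (T.dist x y : ℝ)) where
  self x := by simp
  symm x y := by rw [SimpleGraph.dist_comm]
  lap_eq := ⟨fun x => 2 - deg T x, fun x y => lap_dist hT x y⟩

theorem sum_deg {T : SimpleGraph V} (hT : T.IsTree) :
    ∑ x, deg T x = 2 * ((Fintype.card V : ℝ) - 1) := by
  classical
  have h1 := T.sum_degrees_eq_twice_card_edges
  have h2 := hT.card_edgeFinset
  have h3 : ∑ x, deg T x = ((∑ x, T.degree x : ℕ) : ℝ) := by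
    push_cast
    refine sum_congr rfl fun x _ => ?_
    rw [deg]
  rw [h3, h1, ← h2]; push_cast; ring

/-- In a tree, the degree-weighted sum of distances from a vertex. -/
theorem sum_deg_mul_dist {T : SimpleGraph V} (hT : T.IsTree) (y : V) :
    ∑ x, deg T x * (T.dist x y : ℝ)
      = 2 * ∑ x, (T.dist x y : ℝ) - ((Fintype.card V : ℝ) - 1) := by
  classical
  -- The distance to `y` changes by one along each edge, so its Dirichlet energy is the number of
  -- edges.
  have h1 := sum_mul_lap T (fun z => (T.dist z y : ℝ)) (fun z => (T.dist z y : ℝ))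
  have h2 : (∑ x, ∑ z, if T.Adj x z then
      ((T.dist x y : ℝ) - (T.dist z y : ℝ)) * ((T.dist x y : ℝ) - (T.dist z y : ℝ)) else 0)
      = ∑ x, deg T x := by
    refine sum_congr rfl fun x _ => ?_
    rw [deg_eq_sum]
    refine sum_congr rfl fun z _ => ?_
    by_cases hz : T.Adj x z
    · rw [if_pos hz, if_pos hz]
      rcases hT.dist_eq_dist_add_one_of_adj y hz with h | h <;>
      · rw [SimpleGraph.dist_comm, T.dist_comm (u := y)] at h
        rw [h]; push_cast; ring
    · simp [hz]
  rw [h2, sum_deg hT] at h1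
  simp only [lap_dist hT] at h1
  have h3 : ∀ x, (T.dist x y : ℝ) * ((2 - deg T x) - if x = y then 2 else 0)
      = 2 * (T.dist x y : ℝ) - deg T x * (T.dist x y : ℝ) := by
    intro x
    by_cases hx : x = y
    · subst hx; simp
    · simp [hx]; ring
  simp only [h3] at h1
  rw [sum_sub_distrib, ← mul_sum] at h1
  linarith

end TreeDistance

/-! ### Adding an edge: rank one update of Laplacian and resistance. -/

section AddEdge

variable {V : Type*}

theorem ite_sup_edge_adj {G : SimpleGraph V} {u v : V} (huv : u ≠ v) (hadj : ¬ G.Adj u v)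
    (x y : V) (r : ℝ) [Decidable ((G ⊔ SimpleGraph.edge u v).Adj x y)] :
    (if (G ⊔ SimpleGraph.edge u v).Adj x y then r else 0)
      = open Classical in ((if G.Adj x y then r else 0) + (if x = u ∧ y = v then r else 0)
        + if x = v ∧ y = u then r else 0) := by
  classical
  have hadj' : ¬ G.Adj v u := fun h => hadj h.symm
  simp only [SimpleGraph.sup_adj, SimpleGraph.edge_adj]
  by_cases h1 : x = u ∧ y = v
  · obtain ⟨rfl, rfl⟩ := h1
    simp [hadj, huv]
  · by_cases h2 : x = v ∧ y = u
    · obtain ⟨rfl, rfl⟩ := h2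
      simp [hadj', huv, Ne.symm huv]
    · have h3 : ¬ (((x = u ∧ y = v) ∨ (x = v ∧ y = u)) ∧ x ≠ y) := by tauto
      simp only [h1, h2, or_false, false_and, if_false, add_zero]

variable [Fintype V]

theorem lap_sup_edge {G : SimpleGraph V} {u v : V} (huv : u ≠ v) (hadj : ¬ G.Adj u v)
    (f : V → ℝ) (x : V) :
    lap (G ⊔ SimpleGraph.edge u v) f x = lap G f x
      + (open Classical in (if x = u then 1 else 0) - if x = v then 1 else 0) * (f u - f v) := by
  classical
  simp only [lap, ite_sup_edge_adj huv hadj, sum_add_distrib, ite_and]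
  by_cases hxu : x = u
  · subst hxu
    simp [huv]
  · by_cases hxv : x = v
    · subst hxv
      simp [hxu]
    · simp [hxu, hxv]

theorem deg_sup_edge {G : SimpleGraph V} {u v : V} (huv : u ≠ v) (hadj : ¬ G.Adj u v) (x : V) :
    deg (G ⊔ SimpleGraph.edge u v) x = deg G x
      + open Classical in ((if x = u then 1 else 0) + if x = v then 1 else 0) := by
  classical
  simp only [deg_eq_sum, ite_sup_edge_adj huv hadj, sum_add_distrib, ite_and]
  by_cases hxu : x = u
  · subst hxu
    simp [huv]
  · by_cases hxv : x = v
    · subst hxv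
      simp [hxu]
    · simp [hxu, hxv]

/-- Half the difference of the values of `R` at two vertices: up to an additive constant, the
potential of a unit flow between them. -/
noncomputable def potential (R : V → V → ℝ) (u v x : V) : ℝ := (R x v - R x u) / 2

/-- The resistance after adding an edge (a rank one update of the Laplacian). -/
theorem IsResistance.sup_edge {G : SimpleGraph V} {R : V → V → ℝ} (hR : IsResistance G R)
    {u v : V} (huv : u ≠ v) (hadj : ¬ G.Adj u v) (hpos : 0 ≤ R u v) :
    IsResistance (G ⊔ SimpleGraph.edge u v)
      (fun x y => R x y - (potential R u v x - potential R u v y) ^ 2 / (1 + R u v)) where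
  self x := by simp [hR.self]
  symm x y := by rw [hR.symm x y]; ring
  lap_eq := by
    classical
    obtain ⟨c, hc⟩ := hR.lap_eq
    have hD : (1 + R u v) ≠ 0 := by positivity
    -- After expanding the square, the part `φ²` is independent of `y` and goes into `c`; the cross
    -- term, proportional to `φ_y`, cancels against the contribution of the new edge.
    refine ⟨fun x => c x - lap G (fun z => potential R u v z ^ 2) x / (1 + R u v), fun x y => ?_⟩
    have hpot : lap G (potential R u v) x = (if x = u then 1 else 0) - if x = v then 1 else 0 := by
      have h1 : potential R u v = fun z => (1 / 2) * R z v + (-1 / 2) * R z u := by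
        funext z; rw [potential]; ring
      rw [h1, lap_linear, hc, hc]
      split_ifs <;> ring
    have h1 : (fun z => R z y - (potential R u v z - potential R u v y) ^ 2 / (1 + R u v))
        = fun z => 1 * R z y + 1 * ((-1 / (1 + R u v)) * potential R u v z ^ 2
          + 1 * ((2 * potential R u v y / (1 + R u v)) * potential R u v z
          + (-potential R u v y ^ 2 / (1 + R u v)) * 1)) := by
      funext z; field_simp; ring
    have h2 : lap G (fun _ => (1 : ℝ)) x = 0 := by simp [lap]
    have h3 : potential R u v u = R u v / 2 := by rw [potential, hR.self]; ring
    have h4 : potential R u v v = - R u v / 2 := by rw [potential, hR.self, hR.symm v u]; ring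
    have h5 : R u y - R v y = - 2 * potential R u v y := by
      rw [potential, hR.symm u y, hR.symm v y]; ring
    rw [lap_sup_edge huv hadj, h1, lap_linear, lap_linear, lap_linear, hc, h2, hpot,
      h3, h4]
    have h6 : R u y = R v y - 2 * potential R u v y := by linarith
    rw [h6]
    field_simp
    ring

end AddEdge

/-! ### The change of Kemeny's constant in terms of distances and energy. -/

section Difference

variable {V : Type*} [Fintype V]

theorem sum_deg_sup_edge_mul {G : SimpleGraph V} {u v : V} (huv : u ≠ v) (hadj : ¬ G.Adj u v)
    (f : V → ℝ) :
    ∑ x, deg (G ⊔ SimpleGraph.edge u v) x * f x = ∑ x, deg G x * f x + f u + f v := by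
  classical
  simp only [deg_sup_edge huv hadj, add_mul, sum_add_distrib, ite_mul, one_mul, zero_mul]
  simp [add_assoc]

/-- The sum of the distances to a vertex. -/
noncomputable def transmission (T : SimpleGraph V) (y : V) : ℝ := ∑ x, (T.dist x y : ℝ)

theorem sum_deg_mul_transmission {T : SimpleGraph V} (hT : T.IsTree) :
    ∑ x, deg T x * transmission T x
      = 2 * ∑ x, transmission T x - (Fintype.card V : ℝ) * ((Fintype.card V : ℝ) - 1) := by
  simp only [transmission, mul_sum]
  rw [sum_comm]
  have h : ∀ y, ∑ x, deg T x * (T.dist y x : ℝ)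
      = 2 * ∑ x, (T.dist x y : ℝ) - ((Fintype.card V : ℝ) - 1) := fun y => by
    rw [← sum_deg_mul_dist hT]
    exact sum_congr rfl fun x _ => by rw [SimpleGraph.dist_comm]
  simp only [h, sum_sub_distrib, mul_sum]
  simp [mul_sub]

theorem kemeny_tree {T : SimpleGraph V} [Nontrivial V] (hT : T.IsTree) (j : V) :
    kemeny T j * (4 * ((Fintype.card V : ℝ) - 1)) = 4 * ∑ x, transmission T x
      - 2 * (Fintype.card V : ℝ) * ((Fintype.card V : ℝ) - 1)
      - 2 * ((Fintype.card V : ℝ) - 1) ^ 2 := by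
  have hn : (1 : ℝ) < Fintype.card V := by exact_mod_cast Fintype.one_lt_card
  have hM : (Fintype.card V : ℝ) - 1 ≠ 0 := by linarith
  rw [(isResistance_dist hT).kemeny_eq hT.connected, sum_deg hT]
  have h : ∀ x, ∑ y, deg T x * deg T y * (T.dist x y : ℝ)
      = 2 * (deg T x * transmission T x) - ((Fintype.card V : ℝ) - 1) * deg T x := by
    intro x
    have := sum_deg_mul_dist hT x
    simp only [mul_assoc, ← mul_sum]
    simp only [T.dist_comm (u := x), this, transmission]
    ring
  simp only [h, sum_sub_distrib, ← mul_sum, sum_deg_mul_transmission hT, sum_deg hT]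
  field_simp
  ring

/-- The energy `∑ d_x d_y (φ_x - φ_y)²` of the potential of the added edge. -/
noncomputable def energy (T : SimpleGraph V) (u v : V) : ℝ :=
  ∑ x, ∑ y, deg (T ⊔ SimpleGraph.edge u v) x * deg (T ⊔ SimpleGraph.edge u v) y *
    (potential (fun x y => (T.dist x y : ℝ)) u v x
      - potential (fun x y => (T.dist x y : ℝ)) u v y) ^ 2

theorem kemeny_sup_edge {T : SimpleGraph V} [Nontrivial V] (hT : T.IsTree) {u v : V}
    (huv : u ≠ v) (hadj : ¬ T.Adj u v) (i : V) :
    kemeny (T ⊔ SimpleGraph.edge u v) i * (4 * (Fintype.card V : ℝ)) =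
      4 * ∑ x, transmission T x
      - 2 * (Fintype.card V : ℝ) * ((Fintype.card V : ℝ) - 1)
      - 2 * ((Fintype.card V : ℝ) - 1) ^ 2
      + 4 * (transmission T u + transmission T v) - 4 * ((Fintype.card V : ℝ) - 1)
      + 2 * (T.dist u v : ℝ) - energy T u v / (1 + (T.dist u v : ℝ)) := by
  classical
  have hn : (0 : ℝ) < Fintype.card V := by exact_mod_cast Fintype.card_pos
  have hD : (0 : ℝ) ≤ (T.dist u v : ℝ) := Nat.cast_nonneg _
  have hconn : (T ⊔ SimpleGraph.edge u v).Connected := hT.connected.mono le_sup_left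
  rw [((isResistance_dist hT).sup_edge huv hadj hD).kemeny_eq hconn]
  have hs : ∑ x, deg (T ⊔ SimpleGraph.edge u v) x = 2 * (Fintype.card V : ℝ) := by
    have := sum_deg_sup_edge_mul huv hadj (fun _ => 1)
    simp only [mul_one, sum_deg hT] at this
    linarith
  obtain ⟨h, hh⟩ : ∃ h : V → ℝ, h = fun x => 2 * transmission T x - ((Fintype.card V : ℝ) - 1)
    + T.dist x u + T.dist x v := ⟨_, rfl⟩
  have h1 : ∀ x, ∑ y, deg (T ⊔ SimpleGraph.edge u v) y * (T.dist x y : ℝ) = h x := by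
    intro x
    rw [sum_deg_sup_edge_mul huv hadj]
    have := sum_deg_mul_dist hT x
    simp only [T.dist_comm (v := x)] at this
    rw [this, hh]
    simp only [T.dist_comm (u := x), transmission]
  have h2 : ∑ x, deg (T ⊔ SimpleGraph.edge u v) x * h x = 4 * ∑ x, transmission T x
      - 2 * (Fintype.card V : ℝ) * ((Fintype.card V : ℝ) - 1)
      - 2 * ((Fintype.card V : ℝ) - 1) ^ 2
      + 4 * (transmission T u + transmission T v) - 4 * ((Fintype.card V : ℝ) - 1)
      + 2 * (T.dist u v : ℝ) := by
    have e : ∑ x, deg T x * h x = 2 * ∑ x, deg T x * transmission T x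
        - ((Fintype.card V : ℝ) - 1) * ∑ x, deg T x + ∑ x, deg T x * (T.dist x u : ℝ)
        + ∑ x, deg T x * (T.dist x v : ℝ) := by
      rw [hh, mul_sum, mul_sum, ← sum_sub_distrib, ← sum_add_distrib, ← sum_add_distrib]
      exact sum_congr rfl fun x _ => by ring
    rw [sum_deg_sup_edge_mul huv hadj, e, sum_deg_mul_transmission hT, sum_deg hT,
      sum_deg_mul_dist hT, sum_deg_mul_dist hT, hh]
    simp only [transmission, SimpleGraph.dist_self, T.dist_comm (u := v) (v := u)]
    push_cast
    ring
  rw [hs, show (2 * (2 * (Fintype.card V : ℝ))) = 4 * (Fintype.card V : ℝ) by ring,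
    div_mul_cancel₀ _ (by positivity), energy, ← h2, sum_div, ← sum_sub_distrib]
  refine sum_congr rfl fun x _ => ?_
  rw [← h1, mul_sum, sum_div, ← sum_sub_distrib]
  refine sum_congr rfl fun y _ => ?_
  ring

/-- The change of Kemeny's constant when an edge is added to a tree. -/
theorem kemeny_sub_kemeny {T : SimpleGraph V} [Nontrivial V] (hT : T.IsTree) {u v : V}
    (huv : u ≠ v) (hadj : ¬ T.Adj u v) (i j : V) :
    kemeny (T ⊔ SimpleGraph.edge u v) i - kemeny T j =
      (4 * (((Fintype.card V : ℝ) - 1) * (transmission T u + transmission T v)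
          - ∑ x, transmission T x) / ((Fintype.card V : ℝ) - 1)
        + 2 * ((T.dist u v : ℝ) + 1) - energy T u v / (1 + (T.dist u v : ℝ)))
      / (4 * (Fintype.card V : ℝ)) := by
  have hn : (1 : ℝ) < Fintype.card V := by exact_mod_cast Fintype.one_lt_card
  have hM : (Fintype.card V : ℝ) - 1 ≠ 0 := by linarith
  have h1 := kemeny_tree hT j
  have h2 := kemeny_sup_edge hT huv hadj i
  rw [← eq_div_iff (by positivity)] at h1 h2
  rw [h1, h2]
  obtain ⟨z, hz⟩ : ∃ z, z = energy T u v / (1 + (T.dist u v : ℝ)) := ⟨_, rfl⟩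
  rw [← hz]
  field_simp
  ring

end Difference

/-! ### Lower bound for the energy. -/

section Energy

theorem sum_sum_mul_sub_sq {ι : Type*} (s : Finset ι) (w f : ι → ℝ) :
    ∑ x ∈ s, ∑ y ∈ s, w x * w y * (f x - f y) ^ 2
      = 2 * (∑ x ∈ s, w x) * (∑ x ∈ s, w x * f x ^ 2) - 2 * (∑ x ∈ s, w x * f x) ^ 2 := by
  have h : ∀ x, ∑ y ∈ s, w x * w y * (f x - f y) ^ 2 = (w x * f x ^ 2) * (∑ y ∈ s, w y)
      - 2 * ((w x * f x) * ∑ y ∈ s, w y * f y) + w x * ∑ y ∈ s, w y * f y ^ 2 := by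
    intro x
    simp only [mul_sum]
    rw [← sum_sub_distrib, ← sum_add_distrib]
    exact sum_congr rfl fun y _ => by ring
  simp only [h, sum_add_distrib, sum_sub_distrib, ← mul_sum, ← sum_mul]
  ring

/-- Write `w = 2p + t` with `t ≥ 0`. The first moment of `f` under `w` equals that under `t`, so
Cauchy–Schwarz for `t` controls the subtracted square; the product `(∑ p) (∑ t f²)` that is left
over is nonnegative. -/
theorem le_sum_sum_mul_sub_sq {ι : Type*} (s : Finset ι) {w p : ι → ℝ} {f : ι → ℝ}
    (hp : ∀ x ∈ s, 0 ≤ p x) (hw : ∀ x ∈ s, 2 * p x ≤ w x) (hf : ∑ x ∈ s, p x * f x = 0) :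
    4 * (∑ x ∈ s, w x) * (∑ x ∈ s, p x * f x ^ 2)
      ≤ ∑ x ∈ s, ∑ y ∈ s, w x * w y * (f x - f y) ^ 2 := by
  rw [sum_sum_mul_sub_sq]
  have ht : ∀ x ∈ s, 0 ≤ w x - 2 * p x := fun x hx => by linarith [hw x hx]
  have hcs := sum_sq_le_sum_mul_sum_of_sq_le_mul s (r := fun x => (w x - 2 * p x) * f x)
    (f := fun x => w x - 2 * p x) (g := fun x => (w x - 2 * p x) * f x ^ 2) ht
    (fun x hx => mul_nonneg (ht x hx) (sq_nonneg _)) (fun x _ => le_of_eq (by ring))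
  simp only [sub_mul, mul_assoc, sum_sub_distrib, ← mul_sum, hf] at hcs
  have h1 : 0 ≤ ∑ x ∈ s, p x := sum_nonneg hp
  have h2 : 0 ≤ ∑ x ∈ s, (w x * f x ^ 2) - 2 * ∑ x ∈ s, p x * f x ^ 2 := by
    rw [mul_sum, ← sum_sub_distrib]
    refine sum_nonneg fun x hx => ?_
    have := mul_nonneg (ht x hx) (sq_nonneg (f x))
    linarith
  have h3 := mul_nonneg h1 h2
  nlinarith

/-- A geodesic between two vertices. -/
theorem exists_geodesic {V : Type*} {G : SimpleGraph V} (hG : G.Connected) (u v : V) :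
    ∃ c : ℕ → V, (∀ a ≤ G.dist u v, G.dist u (c a) = a ∧ G.dist (c a) v + a = G.dist u v) ∧
      ∀ a < G.dist u v, G.Adj (c a) (c (a + 1)) := by
  obtain ⟨p, hp⟩ := hG.exists_walk_length_eq_dist u v
  refine ⟨p.getVert, fun a ha => ?_, fun a ha => p.adj_getVert_succ (hp ▸ ha)⟩
  have h1 : G.dist u (p.getVert a) ≤ a :=
    (SimpleGraph.dist_le (p.take a)).trans (by simp)
  have h2 : G.dist (p.getVert a) v ≤ G.dist u v - a :=
    (SimpleGraph.dist_le (p.drop a)).trans (by simp [hp])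
  have h3 : G.dist u v ≤ G.dist u (p.getVert a) + G.dist (p.getVert a) v := hG.dist_triangle
  omega

variable {V : Type*} [Fintype V]

theorem one_le_deg [Nontrivial V] {G : SimpleGraph V} (hG : G.Connected) (x : V) :
    1 ≤ deg G x := by
  classical
  have := hG.preconnected.degree_pos_of_nontrivial x
  rw [deg]; exact_mod_cast this

theorem two_le_deg {G : SimpleGraph V} {x y z : V} (hy : G.Adj x y) (hz : G.Adj x z)
    (hyz : y ≠ z) : 2 ≤ deg G x := by
  classical
  have h : ({y, z} : Finset V) ⊆ G.neighborFinset x := by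
    intro w hw
    rcases mem_insert.mp hw with rfl | hw
    · simpa using hy
    · rw [mem_singleton] at hw; subst hw; simpa using hz
  have := card_le_card h
  rw [card_pair hyz, SimpleGraph.card_neighborFinset_eq_degree] at this
  rw [deg]; exact_mod_cast this

theorem le_energy [Nontrivial V] {T : SimpleGraph V} (hT : T.IsTree) {u v : V}
    (huv : u ≠ v) (hadj : ¬ T.Adj u v) :
    2 / 3 * (Fintype.card V : ℝ) * (T.dist u v : ℝ) * ((T.dist u v : ℝ) + 1)
      * ((T.dist u v : ℝ) + 2) ≤ energy T u v := by
  classical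
  obtain ⟨c, hc, hcadj⟩ := exists_geodesic hT.connected u v
  obtain ⟨D, hD⟩ : ∃ D, D = T.dist u v := ⟨_, rfl⟩
  have hsum : ∑ x, deg (T ⊔ SimpleGraph.edge u v) x = 2 * (Fintype.card V : ℝ) := by
    have := sum_deg_sup_edge_mul huv hadj (fun _ => 1)
    simp only [mul_one, sum_deg hT] at this
    linarith
  rw [← hD] at hc hcadj ⊢
  have hinj : Set.InjOn c (range (D + 1)) := by
    intro a ha b hb hab
    simp only [coe_range, Set.mem_Iio] at ha hb
    have h1 := (hc a (by omega)).1
    have h2 := (hc b (by omega)).1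
    rw [hab] at h1; omega
  have hφ : ∀ a ∈ range (D + 1),
      potential (fun x y => (T.dist x y : ℝ)) u v (c a) = (D - 2 * a) / 2 := by
    intro a ha
    have h1 := hc a (by simpa [Nat.lt_succ_iff] using ha)
    rw [T.dist_comm] at h1
    have h2 : (T.dist (c a) v : ℝ) + a = D := by exact_mod_cast h1.2
    rw [potential, h1.1]
    linarith
  have hpsum : ∀ g : V → ℝ, ∑ x, (if x ∈ (range (D + 1)).image c then (1 : ℝ) else 0) * g x
      = ∑ a ∈ range (D + 1), g (c a) := by
    intro g
    simp only [ite_mul, one_mul, zero_mul]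
    rw [sum_ite_mem, univ_inter, sum_image hinj]
  -- The offset `z` is independent of `m` to permit induction; it is used with `m = D + 1` and `z =
  -- D`.
  have hlin : ∀ m : ℕ, ∀ z : ℝ, ∑ a ∈ range m, (z - 2 * (a : ℝ)) / 2 = m * (z - m + 1) / 2 := by
    intro m z
    induction m with
    | zero => simp
    | succ m ih => rw [sum_range_succ, ih]; push_cast; ring
  have hquad : ∀ m : ℕ, ∀ z : ℝ, ∑ a ∈ range m, ((z - 2 * (a : ℝ)) / 2) ^ 2
      = m * (3 * z ^ 2 - 6 * z * (m - 1) + 2 * (m - 1) * (2 * m - 1)) / 12 := by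
    intro m z
    induction m with
    | zero => simp
    | succ m ih => rw [sum_range_succ, ih]; push_cast; ring
  -- Here `p` is the indicator function of the geodesic, on which the values of the potential sum to
  -- zero.
  have key := le_sum_sum_mul_sub_sq univ (w := deg (T ⊔ SimpleGraph.edge u v))
    (p := fun x => if x ∈ (range (D + 1)).image c then (1 : ℝ) else 0)
    (f := potential (fun x y => (T.dist x y : ℝ)) u v)
    (fun x _ => by split_ifs <;> norm_num) ?_ ?_
  · rw [hsum, hpsum (fun x => potential (fun x y => (T.dist x y : ℝ)) u v x ^ 2),
      sum_congr rfl (fun a ha => by rw [hφ a ha]), hquad] at key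
    rw [energy]
    refine le_trans (le_of_eq ?_) key
    push_cast
    ring
  · intro x _
    have h0 := one_le_deg hT.connected x
    rw [deg_sup_edge huv hadj]
    split_ifs with hx h1 h2 h2 h1 h2 h2
    any_goals linarith
    -- Off the path there is nothing to show, and `u`, `v` gain one from the new edge. An interior
    -- vertex of the path has its predecessor and successor as neighbours.
    obtain ⟨a, ha, rfl⟩ := mem_image.mp hx
    rw [mem_range] at ha
    have ha0 : a ≠ 0 := by
      rintro rfl
      exact h1 (hT.connected.dist_eq_zero_iff.mp (hc 0 (by omega)).1).symm
    have haD : a ≠ D := by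
      rintro rfl
      have := (hc a le_rfl).2
      exact h2 (hT.connected.dist_eq_zero_iff.mp (by omega))
    obtain ⟨b, rfl⟩ := Nat.exists_eq_succ_of_ne_zero ha0
    have hne : c b ≠ c (b + 2) := by
      intro h
      have e1 := (hc b (by omega)).1
      have e2 := (hc (b + 2) (by omega)).1
      rw [h] at e1; omega
    have := two_le_deg (hcadj b (by omega)).symm (hcadj (b + 1) (by omega)) hne
    simp only [Nat.succ_eq_add_one]
    linarith
  · rw [hpsum, sum_congr rfl hφ, hlin]
    push_cast
    ring

end Energy

/-! ### Sums of pairwise minima of a function without gaps. -/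

section MinSum

variable {ι : Type*}

/-- Layer cake: the minimum counts the levels `h` lying below both values. Subtracting the sum of
`f` removes the diagonal pairs. -/
theorem sum_min_eq (S : Finset ι) (f : ι → ℕ) (m : ℕ) (hm : ∀ x ∈ S, f x ≤ m) :
    ∑ x ∈ S, ∑ y ∈ S, (min (f x) (f y) : ℝ) - ∑ x ∈ S, (f x : ℝ)
      = ∑ h ∈ range m, (#{x ∈ S | h < f x} : ℝ) * ((#{x ∈ S | h < f x} : ℝ) - 1) := by
  have h1 : ∀ a ≤ m, (a : ℝ) = ∑ h ∈ range m, if h < a then (1 : ℝ) else 0 := by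
    intro a ha
    rw [← sum_filter, sum_const, nsmul_eq_mul, mul_one]
    have : {h ∈ range m | h < a} = range a := by
      ext; simp; omega
    rw [this, card_range]
  have h2 : ∀ h, (#{x ∈ S | h < f x} : ℝ) = ∑ x ∈ S, if h < f x then (1 : ℝ) else 0 := by
    intro h; simp
  have h3 : ∑ x ∈ S, (f x : ℝ) = ∑ h ∈ range m, (#{x ∈ S | h < f x} : ℝ) := by
    simp only [h2]
    rw [sum_comm]
    exact sum_congr rfl fun x hx => h1 _ (hm x hx)
  have h4 : ∑ x ∈ S, ∑ y ∈ S, (min (f x) (f y) : ℝ)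
      = ∑ h ∈ range m, (#{x ∈ S | h < f x} : ℝ) * (#{x ∈ S | h < f x} : ℝ) := by
    have e : ∀ x ∈ S, ∀ y ∈ S, (min (f x) (f y) : ℝ) = ∑ h ∈ range m,
        (if h < f x then (1 : ℝ) else 0) * if h < f y then (1 : ℝ) else 0 := by
      intro x hx y hy
      have := h1 (min (f x) (f y)) ((min_le_left _ _).trans (hm x hx))
      rw [Nat.cast_min] at this
      rw [this]
      refine sum_congr rfl fun h _ => ?_
      simp only [lt_min_iff, ite_and]
      split_ifs <;> simp
    simp only [h2, sum_mul_sum]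
    rw [sum_congr rfl fun x hx => sum_congr rfl fun y hy => e x hx y hy]
    exact (sum_congr rfl fun x _ => sum_comm).trans sum_comm
  rw [h3, h4, ← sum_sub_distrib]
  exact sum_congr rfl fun h _ => by ring

theorem sum_range_mul_pred (m : ℕ) :
    ∑ j ∈ range m, (j : ℝ) * ((j : ℝ) - 1) = (m : ℝ) * (m - 1) * (m - 2) / 3 := by
  induction m with
  | zero => simp
  | succ m ih => rw [sum_range_succ, ih]; push_cast; ring

/-- If the values of `f` on `S` have no gaps, then the sum of the minima over pairs of distinct
elements is at most its value for `0, 1, …, #S - 1`. -/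
theorem sum_min_le (S : Finset ι) (f : ι → ℕ)
    (hf : ∀ x ∈ S, ∀ h ≤ f x, ∃ y ∈ S, f y = h) :
    ∑ x ∈ S, ∑ y ∈ S, (min (f x) (f y) : ℝ) - ∑ x ∈ S, (f x : ℝ)
      ≤ (#S : ℝ) * (#S - 1) * (#S - 2) / 3 := by
  classical
  -- Each of the values `0, …, h` is attained, so at most `#S - 1 - h` elements lie above level `h`.
  have hcard : ∀ x ∈ S, ∀ h ≤ f x, h + 1 ≤ #{y ∈ S | f y ≤ h} := by
    intro x hx h hh
    have : range (h + 1) ⊆ ({y ∈ S | f y ≤ h}).image f := by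
      intro a ha
      rw [mem_range] at ha
      obtain ⟨y, hy, rfl⟩ := hf x hx a (by omega)
      exact mem_image_of_mem _ (mem_filter.mpr ⟨hy, by omega⟩)
    have := (card_le_card this).trans card_image_le
    rwa [card_range] at this
  have hm : ∀ x ∈ S, f x ≤ #S := fun x hx => by
    have := hcard x hx _ le_rfl
    have h2 := card_filter_le S (fun y => f y ≤ f x)
    omega
  rw [sum_min_eq S f #S hm, ← sum_range_mul_pred,
    ← sum_range_reflect (fun j => (j : ℝ) * ((j : ℝ) - 1))]
  refine sum_le_sum fun h hh => ?_
  rw [mem_range] at hh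
  obtain ⟨N, hN⟩ : ∃ N, N = #{x ∈ S | h < f x} := ⟨_, rfl⟩
  have hle : N ≤ #S - 1 - h := by
    rcases Nat.eq_zero_or_pos N with h0 | h0
    · omega
    · obtain ⟨x, hx⟩ := card_pos.mp (hN ▸ h0)
      rw [mem_filter] at hx
      have h1 := hcard x hx.1 h hx.2.le
      have h2 := card_filter_add_card_filter_not (s := S) (fun y => f y ≤ h)
      simp only [not_le] at h2
      omega
  rw [← hN]
  -- The function `t * (t - 1)` is not monotone on `[0, 1]`, hence the separate treatment of empty
  -- levels.
  rcases Nat.eq_zero_or_pos N with h0 | h0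
  · rw [h0]
    rcases Nat.eq_zero_or_pos (#S - 1 - h) with h1 | h1
    · rw [h1]
    · have : (1 : ℝ) ≤ ((#S - 1 - h : ℕ) : ℝ) := by exact_mod_cast h1
      push_cast [zero_mul]
      nlinarith
  · have h1 : (1 : ℝ) ≤ N := by exact_mod_cast h0
    have h2 : (N : ℝ) ≤ ((#S - 1 - h : ℕ) : ℝ) := by exact_mod_cast hle
    nlinarith

theorem sum_min_eq_of_bijOn (S : Finset ι) (f : ι → ℕ) (m : ℕ)
    (hf : Set.BijOn f S (range m)) :
    ∑ x ∈ S, ∑ y ∈ S, (min (f x) (f y) : ℝ) - ∑ x ∈ S, (f x : ℝ)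
      = (m : ℝ) * (m - 1) * (m - 2) / 3 := by
  classical
  have himg : S.image f = range m := by
    rw [← coe_inj, coe_image]; exact hf.image_eq
  have hsum : ∀ g : ℕ → ℝ, ∑ x ∈ S, g (f x) = ∑ a ∈ range m, g a := fun g => by
    rw [← himg, sum_image hf.injOn]
  have h1 : ∀ x, ∑ y ∈ S, (min (f x) (f y) : ℝ) = ∑ b ∈ range m, (min (f x) b : ℝ) := fun x =>
    hsum (fun b => (min (f x) b : ℝ))
  simp only [h1]
  rw [hsum (fun a => ∑ b ∈ range m, (min a b : ℝ)), hsum (fun a => (a : ℝ))]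
  have hlin : ∀ k : ℕ, ∑ a ∈ range k, (a : ℝ) = k * (k - 1) / 2 := by
    intro k
    induction k with
    | zero => simp
    | succ k ih => rw [sum_range_succ, ih]; push_cast; ring
  have hmin : ∀ k : ℕ, ∑ a ∈ range k, ∑ b ∈ range k, (min a b : ℝ)
      = k * (k - 1) * (2 * k - 1) / 6 := by
    intro k
    induction k with
    | zero => simp
    | succ k ih =>
      have e1 : ∀ a ∈ range k, (min a k : ℝ) = a := fun a ha => by
        rw [min_eq_left]; exact_mod_cast (mem_range.mp ha).le
      have e2 : ∀ a ∈ range k, (min k a : ℝ) = a := fun a ha => by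
        rw [min_eq_right]; exact_mod_cast (mem_range.mp ha).le
      simp only [sum_range_succ, sum_add_distrib, ih, min_self]
      rw [sum_congr rfl e1, sum_congr rfl e2, hlin]
      push_cast
      ring
  rw [hmin, hlin]
  ring

end MinSum

/-! ### Height above the path, potential, and the excess of the transmissions. -/

section Profile

variable {V : Type*}

/-- The distance of `x` to the path between `u` and `v` in a tree. -/
noncomputable def rho (T : SimpleGraph V) (u v x : V) : ℕ :=
  (T.dist u x + T.dist v x - T.dist u v) / 2

theorem two_mul_rho {T : SimpleGraph V} (hT : T.IsTree) (u v x : V) :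
    2 * rho T u v x + T.dist u v = T.dist u x + T.dist v x := by
  -- Along an edge both distances change by one, so the parity of their sum is the one it has at
  -- `u`. Thus the division in `rho` is exact.
  have hpar : (T.dist u x + T.dist v x + T.dist u v) % 2 = 0 := by
    have hw : ∀ {y z : V} (p : T.Walk y z), (T.dist u y + T.dist v y) % 2
        = (T.dist u z + T.dist v z) % 2 := by
      intro y z p
      induction p with
      | nil => rfl
      | cons h p ih =>
        rw [← ih]
        have h1 := hT.dist_eq_dist_add_one_of_adj u h
        have h2 := hT.dist_eq_dist_add_one_of_adj v h
        omega
    obtain ⟨p⟩ := hT.connected.preconnected u x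
    have := hw p
    rw [SimpleGraph.dist_self, T.dist_comm (u := v) (v := u)] at this
    omega
  have htri : T.dist u v ≤ T.dist u x + T.dist x v := hT.connected.dist_triangle
  rw [T.dist_comm (u := x)] at htri
  rw [rho]
  omega

theorem rho_left (T : SimpleGraph V) (u v : V) : rho T u v u = 0 := by
  simp [rho, T.dist_comm (u := v) (v := u)]

theorem rho_right (T : SimpleGraph V) (u v : V) : rho T u v v = 0 := by
  simp [rho]

theorem rho_adj {T : SimpleGraph V} (hT : T.IsTree) (u v : V) {x y : V} (h : T.Adj x y) :
    rho T u v y ≤ rho T u v x + 1 := by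
  have h1 := hT.dist_eq_dist_add_one_of_adj u h
  have h2 := hT.dist_eq_dist_add_one_of_adj v h
  have h3 := two_mul_rho hT u v x
  have h4 := two_mul_rho hT u v y
  omega

/-- A discrete intermediate value argument: the height is `0` at `u` and grows by at most one along
an edge. Positive heights avoid `u` and `v` automatically; for height `0` the witness is the vertex
after `u` on the geodesic, which is not `v` because `D ≥ 2`. -/
theorem exists_rho_eq {T : SimpleGraph V} (hT : T.IsTree) {u v : V} (huv : u ≠ v)
    (hadj : ¬ T.Adj u v) (x : V) (h : ℕ) (hh : h ≤ rho T u v x) :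
    ∃ y, y ≠ u ∧ y ≠ v ∧ rho T u v y = h := by
  rcases Nat.eq_zero_or_pos h with rfl | hpos
  · obtain ⟨c, hc, -⟩ := exists_geodesic hT.connected u v
    have hD := hT.connected.one_lt_dist_of_ne_of_not_adj huv hadj
    have h1 := hc 1 hD.le
    refine ⟨c 1, ?_, ?_, ?_⟩
    · intro h; rw [h, SimpleGraph.dist_self] at h1; omega
    · intro h; rw [h, SimpleGraph.dist_self] at h1; omega
    · have := two_mul_rho hT u v (c 1)
      rw [T.dist_comm (u := v)] at this
      omega
  · by_contra hne
    push Not at hne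
    have hne' : ∀ y, rho T u v y ≠ h := by
      intro y hy
      by_cases hyu : y = u
      · subst hyu; rw [rho_left] at hy; omega
      by_cases hyv : y = v
      · subst hyv; rw [rho_right] at hy; omega
      exact hne y hyu hyv hy
    have hw : ∀ {y z : V} (p : T.Walk y z), rho T u v y < h → rho T u v z < h := by
      intro y z p
      induction p with
      | nil => exact id
      | @cons a b c hab p ih =>
        intro ha
        refine ih ?_
        have h1 := rho_adj hT u v hab
        have h2 := hne' b
        omega
    obtain ⟨p⟩ := hT.connected.preconnected u x
    have := hw p (by rw [rho_left]; exact hpos)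
    omega

/-- The defect in the triangle inequalities bounding the distance from below. -/
noncomputable def slack (T : SimpleGraph V) (u v x y : V) : ℝ :=
  (T.dist x y : ℝ) - |(rho T u v x : ℝ) - rho T u v y|
    - |potential (fun x y => (T.dist x y : ℝ)) u v x - potential (fun x y => (T.dist x y : ℝ)) u v y|

theorem rho_cast {T : SimpleGraph V} (hT : T.IsTree) (u v x : V) :
    (rho T u v x : ℝ) = ((T.dist u x : ℝ) + T.dist v x - T.dist u v) / 2 := by
  have := two_mul_rho hT u v x
  have h : 2 * (rho T u v x : ℝ) + T.dist u v = T.dist u x + T.dist v x := by exact_mod_cast this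
  linarith

/-- Up to a constant, `ρ + φ` and `ρ - φ` are the distances to `v` and to `u`. Each choice of signs
in the two absolute values is thus one triangle inequality. -/
theorem slack_nonneg {T : SimpleGraph V} (hT : T.IsTree) (u v x y : V) :
    0 ≤ slack T u v x y := by
  have tri : ∀ a b c, (T.dist a c : ℝ) ≤ T.dist a b + T.dist b c := fun a b c => by
    exact_mod_cast hT.connected.dist_triangle
  have h1 := tri u x y
  have h2 := tri u y x
  have h3 := tri v x y
  have h4 := tri v y x
  rw [T.dist_comm (u := y) (v := x)] at h2 h4
  rw [slack, rho_cast hT, rho_cast hT, potential, potential, T.dist_comm (u := x) (v := u),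
    T.dist_comm (u := x) (v := v), T.dist_comm (u := y) (v := u), T.dist_comm (u := y) (v := v)]
  rcases abs_cases (((T.dist u x : ℝ) + T.dist v x - T.dist u v) / 2 -
    ((T.dist u y : ℝ) + T.dist v y - T.dist u v) / 2) with ⟨e1, -⟩ | ⟨e1, -⟩ <;>
  rcases abs_cases (((T.dist v x : ℝ) - T.dist u x) / 2 - ((T.dist v y : ℝ) - T.dist u y) / 2)
    with ⟨e2, -⟩ | ⟨e2, -⟩ <;> rw [e1, e2] <;> linarith

theorem abs_potential_sub {T : SimpleGraph V} (hT : T.IsTree) (u v x : V) :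
    |potential (fun x y => (T.dist x y : ℝ)) u v u - potential (fun x y => (T.dist x y : ℝ)) u v x|
    + |potential (fun x y => (T.dist x y : ℝ)) u v v
        - potential (fun x y => (T.dist x y : ℝ)) u v x| = T.dist u v := by
  have tri : ∀ a b c, (T.dist a c : ℝ) ≤ T.dist a b + T.dist b c := fun a b c => by
    exact_mod_cast hT.connected.dist_triangle
  have h1 := tri u v x
  have h2 := tri v u x
  simp only [potential, SimpleGraph.dist_self]
  rw [T.dist_comm (u := v) (v := u)] at *
  rw [T.dist_comm (u := x) (v := u), T.dist_comm (u := x) (v := v)]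
  push_cast
  rw [abs_of_nonneg (by linarith), abs_of_nonpos (by linarith)]
  ring

variable [Fintype V]

theorem sum_eq_add_add_sum_sdiff [DecidableEq V] {u v : V} (huv : u ≠ v) (f : V → ℝ) :
    ∑ x, f x = f u + f v + ∑ x ∈ univ \ {u, v}, f x := by
  rw [← sum_sdiff (subset_univ {u, v}), sum_pair huv]; ring

/-- The heights enter the first product with coefficient `2 (n - 1)` and the sum of `|ρ_x - ρ_y|`
with `2n`; the difference `-2` is just what removes the diagonal from twice the sum of minima. -/
theorem transmission_excess_eq [DecidableEq V] {T : SimpleGraph V} (hT : T.IsTree) {u v : V}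
    (huv : u ≠ v) :
    ((Fintype.card V : ℝ) - 1) * (transmission T u + transmission T v) - ∑ x, transmission T x
      = 2 * (∑ x ∈ univ \ {u, v}, ∑ y ∈ univ \ {u, v}, (min (rho T u v x) (rho T u v y) : ℝ)
          - ∑ x ∈ univ \ {u, v}, (rho T u v x : ℝ))
        + ((Fintype.card V : ℝ) - 1) * ((Fintype.card V : ℝ) - 2) * T.dist u v
        - ∑ x ∈ univ \ {u, v}, ∑ y ∈ univ \ {u, v},
            |potential (fun x y => (T.dist x y : ℝ)) u v x
              - potential (fun x y => (T.dist x y : ℝ)) u v y|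
        - ∑ x, ∑ y, slack T u v x y := by
  obtain ⟨φ, hφ⟩ : ∃ φ, φ = potential (fun x y => (T.dist x y : ℝ)) u v := ⟨_, rfl⟩
  obtain ⟨n, hn⟩ : ∃ n : ℝ, n = Fintype.card V := ⟨_, rfl⟩
  rw [← hφ, ← hn]
  have hcardS : (#(univ \ {u, v} : Finset V) : ℝ) = n - 2 := by
    have := sum_eq_add_add_sum_sdiff huv (fun _ => 1)
    simp only [sum_const, card_univ, nsmul_eq_mul, mul_one, ← hn] at this
    linarith
  -- The rows of `u` and `v` taken together contribute `D` per column, and likewise their columns.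
  have hΦ : ∑ x, ∑ y, |φ x - φ y| = 2 * (n - 1) * T.dist u v
      + ∑ x ∈ univ \ {u, v}, ∑ y ∈ univ \ {u, v}, |φ x - φ y| := by
    have e0 : ∀ y, |φ u - φ y| + |φ v - φ y| = T.dist u v := fun y => by
      rw [hφ]; exact abs_potential_sub hT u v y
    have e0' : ∀ x, |φ x - φ u| + |φ x - φ v| = T.dist u v := fun x => by
      rw [abs_sub_comm, abs_sub_comm (φ x) (φ v)]; exact e0 x
    rw [sum_eq_add_add_sum_sdiff huv, ← sum_add_distrib]
    simp only [e0]
    have e1 : ∀ x, ∑ y, |φ x - φ y| = T.dist u v + ∑ y ∈ univ \ {u, v}, |φ x - φ y| := fun x => by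
      rw [sum_eq_add_add_sum_sdiff huv, e0']
    simp only [e1, sum_add_distrib, sum_const, nsmul_eq_mul, hcardS, card_univ, ← hn]
    ring
  have hmin : ∑ x, ∑ y, (min (rho T u v x) (rho T u v y) : ℝ)
      = ∑ x ∈ univ \ {u, v}, ∑ y ∈ univ \ {u, v}, (min (rho T u v x) (rho T u v y) : ℝ) := by
    have e1 : ∀ x, ∑ y, (min (rho T u v x) (rho T u v y) : ℝ)
        = ∑ y ∈ univ \ {u, v}, (min (rho T u v x) (rho T u v y) : ℝ) := fun x => by
      rw [sum_eq_add_add_sum_sdiff huv, rho_left, rho_right]; simp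
    simp only [e1]
    rw [sum_eq_add_add_sum_sdiff huv, rho_left, rho_right]; simp
  have hrho : ∑ x, (rho T u v x : ℝ) = ∑ x ∈ univ \ {u, v}, (rho T u v x : ℝ) := by
    rw [sum_eq_add_add_sum_sdiff huv, rho_left, rho_right]; simp
  have hS : transmission T u + transmission T v = 2 * ∑ x, (rho T u v x : ℝ) + n * T.dist u v := by
    rw [transmission, transmission, ← sum_add_distrib, mul_sum, hn, ← card_univ, ← nsmul_eq_mul,
      ← sum_const, ← sum_add_distrib]
    refine sum_congr rfl fun x _ => ?_
    rw [rho_cast hT, T.dist_comm (u := x), T.dist_comm (u := x)]; ring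
  have hW : ∑ x, transmission T x + 2 * ∑ x, ∑ y, (min (rho T u v x) (rho T u v y) : ℝ)
      = ∑ x, ∑ y, slack T u v x y + ∑ x, ∑ y, |φ x - φ y| + 2 * n * ∑ x, (rho T u v x : ℝ) := by
    have e1 : ∑ x : V, ∑ y : V, ((rho T u v x : ℝ) + rho T u v y)
        = 2 * n * ∑ x, (rho T u v x : ℝ) := by
      simp only [sum_add_distrib, sum_const, nsmul_eq_mul, card_univ, ← hn, ← mul_sum]; ring
    rw [← e1]
    simp only [transmission, mul_sum, ← sum_add_distrib]
    refine sum_congr rfl fun x _ => sum_congr rfl fun y _ => ?_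
    rw [slack, ← hφ, T.dist_comm (u := y)]
    rcases le_total (rho T u v x : ℝ) (rho T u v y) with h | h
    · rw [min_eq_left h, abs_of_nonpos (by linarith)]; ring
    · rw [min_eq_right h, abs_of_nonneg (by linarith)]; ring
  rw [← hmin, ← hrho, hS]
  linear_combination (-1 : ℝ) * hW - hΦ

end Profile

/-! ### The bound, and equality as the vanishing of five terms. -/

section Extremal

variable {V : Type*} [Fintype V]

/-- The deficit in the bound on the change of Kemeny's constant, as a sum of five terms. -/
theorem bound_sub_kemeny_sub [DecidableEq V] [Nontrivial V] {T : SimpleGraph V} (hT : T.IsTree)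
    {u v : V} (huv : u ≠ v) (hadj : ¬ T.Adj u v) (i j : V) {n : ℝ} (hn : n = Fintype.card V) :
    (4 * n ^ 3 - 32 * n ^ 2 + 85 * n - 81) / (6 * n * (n - 1))
      - (kemeny (T ⊔ SimpleGraph.edge u v) i - kemeny T j)
    = (4 / (n - 1) * (2 * ((n - 2) * (n - 3) * (n - 4) / 3
          - (∑ x ∈ univ \ {u, v}, ∑ y ∈ univ \ {u, v}, (min (rho T u v x) (rho T u v y) : ℝ)
          - ∑ x ∈ univ \ {u, v}, (rho T u v x : ℝ)))
        + ∑ x ∈ univ \ {u, v}, ∑ y ∈ univ \ {u, v},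
            |potential (fun x y => (T.dist x y : ℝ)) u v x
              - potential (fun x y => (T.dist x y : ℝ)) u v y|
        + ∑ x, ∑ y, slack T u v x y)
      + (energy T u v - 2 / 3 * n * (T.dist u v : ℝ) * ((T.dist u v : ℝ) + 1)
          * ((T.dist u v : ℝ) + 2)) / (1 + (T.dist u v : ℝ))
      + ((T.dist u v : ℝ) - 2) * (2 / 3 * n * ((T.dist u v : ℝ) - 2) + 6)) / (4 * n) := by
  have hn1 : (1 : ℝ) < n := by rw [hn]; exact_mod_cast Fintype.one_lt_card
  have hM : n - 1 ≠ 0 := by linarith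
  have hn0 : n ≠ 0 := by linarith
  have hD : 1 + (T.dist u v : ℝ) ≠ 0 := by positivity
  rw [kemeny_sub_kemeny hT huv hadj, transmission_excess_eq hT huv, ← hn]
  generalize ∑ x, ∑ y, slack T u v x y = s
  generalize (∑ x ∈ univ \ {u, v}, ∑ y ∈ univ \ {u, v}, (min (rho T u v x) (rho T u v y) : ℝ)
          - ∑ x ∈ univ \ {u, v}, (rho T u v x : ℝ)) = m
  generalize ∑ x ∈ univ \ {u, v}, ∑ y ∈ univ \ {u, v},
            |potential (fun x y => (T.dist x y : ℝ)) u v x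
              - potential (fun x y => (T.dist x y : ℝ)) u v y| = p
  generalize energy T u v = e
  generalize (T.dist u v : ℝ) = D at *
  -- The last term compares `4 (n - 2) D + 2 (D + 1) - 2/3 n D (D + 2)` with its value at `D = 2`.
  field_simp
  ring

theorem card_sdiff_pair [DecidableEq V] {u v : V} (huv : u ≠ v) :
    #(univ \ {u, v} : Finset V) + 2 = Fintype.card V := by
  have := card_sdiff_add_card_eq_card (subset_univ ({u, v} : Finset V))
  rwa [card_pair huv, card_univ] at this

theorem sum_min_rho_le [DecidableEq V] {T : SimpleGraph V} (hT : T.IsTree)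
    {u v : V} (huv : u ≠ v) (hadj : ¬ T.Adj u v) {n : ℝ} (hn : n = Fintype.card V) :
    ∑ x ∈ univ \ {u, v}, ∑ y ∈ univ \ {u, v}, (min (rho T u v x) (rho T u v y) : ℝ)
          - ∑ x ∈ univ \ {u, v}, (rho T u v x : ℝ) ≤ (n - 2) * (n - 3) * (n - 4) / 3 := by
  have h := sum_min_le (univ \ {u, v}) (rho T u v) (fun x _ k hk => by
    obtain ⟨y, hyu, hyv, hy⟩ := exists_rho_eq hT huv hadj x k hk
    exact ⟨y, by simp [hyu, hyv], hy⟩)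
  have hc : (#(univ \ {u, v} : Finset V) : ℝ) = n - 2 := by
    rw [hn, ← card_sdiff_pair huv]; push_cast; ring
  rw [hc] at h
  exact h.trans (le_of_eq (by ring))

theorem kemeny_sub_le_and_eq_iff [DecidableEq V] [Nontrivial V] {T : SimpleGraph V}
    (hT : T.IsTree) {u v : V} (huv : u ≠ v) (hadj : ¬ T.Adj u v) (i j : V) {n : ℝ}
    (hn : n = Fintype.card V) :
    kemeny (T ⊔ SimpleGraph.edge u v) i - kemeny T j
      ≤ (4 * n ^ 3 - 32 * n ^ 2 + 85 * n - 81) / (6 * n * (n - 1)) ∧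
    (kemeny (T ⊔ SimpleGraph.edge u v) i - kemeny T j
      = (4 * n ^ 3 - 32 * n ^ 2 + 85 * n - 81) / (6 * n * (n - 1)) ↔
      ∑ x ∈ univ \ {u, v}, ∑ y ∈ univ \ {u, v}, (min (rho T u v x) (rho T u v y) : ℝ)
          - ∑ x ∈ univ \ {u, v}, (rho T u v x : ℝ) = (n - 2) * (n - 3) * (n - 4) / 3 ∧
      (∀ x ∈ univ \ {u, v}, ∀ y ∈ univ \ {u, v},
          potential (fun x y => (T.dist x y : ℝ)) u v x
            = potential (fun x y => (T.dist x y : ℝ)) u v y) ∧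
      (∀ x y, slack T u v x y = 0) ∧
      energy T u v = 2 / 3 * n * (T.dist u v : ℝ) * ((T.dist u v : ℝ) + 1)
          * ((T.dist u v : ℝ) + 2) ∧
      T.dist u v = 2) := by
  have key := bound_sub_kemeny_sub hT huv hadj i j hn
  have hn1 : (1 : ℝ) < n := by rw [hn]; exact_mod_cast Fintype.one_lt_card
  have hM : 0 < n - 1 := by linarith
  have hn0 : 0 < 4 * n := by linarith
  have hD2 : (2 : ℝ) ≤ T.dist u v := by
    exact_mod_cast hT.connected.one_lt_dist_of_ne_of_not_adj huv hadj
  have h1 := sub_nonneg.mpr (sum_min_rho_le hT huv hadj hn)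
  have h2 : ∀ x ∈ univ \ {u, v}, 0 ≤ ∑ y ∈ univ \ {u, v},
            |potential (fun x y => (T.dist x y : ℝ)) u v x
              - potential (fun x y => (T.dist x y : ℝ)) u v y| :=
    fun x _ => sum_nonneg fun y _ => abs_nonneg _
  have h2' := sum_nonneg h2
  have h3 : ∀ x ∈ univ, 0 ≤ ∑ y, slack T u v x y :=
    fun x _ => sum_nonneg fun y _ => slack_nonneg hT u v x y
  have h3' := sum_nonneg h3
  have h4 := sub_nonneg.mpr (le_energy hT huv hadj)
  rw [← hn] at h4
  have h2z : ∑ x ∈ univ \ {u, v}, ∑ y ∈ univ \ {u, v},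
            |potential (fun x y => (T.dist x y : ℝ)) u v x
              - potential (fun x y => (T.dist x y : ℝ)) u v y| = 0 ↔
      ∀ x ∈ univ \ {u, v}, ∀ y ∈ univ \ {u, v},
          potential (fun x y => (T.dist x y : ℝ)) u v x
            = potential (fun x y => (T.dist x y : ℝ)) u v y := by
    rw [sum_eq_zero_iff_of_nonneg h2]
    refine forall₂_congr fun x hx => ?_
    rw [sum_eq_zero_iff_of_nonneg fun y _ => abs_nonneg _]
    simp only [abs_eq_zero, sub_eq_zero]
  have h3z : ∑ x, ∑ y, slack T u v x y = 0 ↔ ∀ x y, slack T u v x y = 0 := by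
    rw [sum_eq_zero_iff_of_nonneg h3]
    simp only [mem_univ, true_imp_iff]
    refine forall_congr' fun x => ?_
    rw [sum_eq_zero_iff_of_nonneg fun y _ => slack_nonneg hT u v x y]
    simp only [mem_univ, true_imp_iff]
  have h5z : T.dist u v = 2 ↔ (T.dist u v : ℝ) = 2 := by norm_cast
  rw [← h2z, ← h3z, h5z]
  generalize ∑ x, ∑ y, slack T u v x y = s at *
  generalize (∑ x ∈ univ \ {u, v}, ∑ y ∈ univ \ {u, v}, (min (rho T u v x) (rho T u v y) : ℝ)
          - ∑ x ∈ univ \ {u, v}, (rho T u v x : ℝ)) = m at *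
  generalize ∑ x ∈ univ \ {u, v}, ∑ y ∈ univ \ {u, v},
            |potential (fun x y => (T.dist x y : ℝ)) u v x
              - potential (fun x y => (T.dist x y : ℝ)) u v y| = p at *
  generalize energy T u v = e at *
  generalize (T.dist u v : ℝ) = D at *
  have hM4 : 0 < 4 / (n - 1) := by positivity
  obtain ⟨A, hA⟩ : ∃ A, A = 4 / (n - 1) * (2 * ((n - 2) * (n - 3) * (n - 4) / 3 - m) + p + s) :=
    ⟨_, rfl⟩
  obtain ⟨B, hB⟩ : ∃ B, B = (e - 2 / 3 * n * D * (D + 1) * (D + 2)) / (1 + D) := ⟨_, rfl⟩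
  obtain ⟨C, hC⟩ : ∃ C, C = (D - 2) * (2 / 3 * n * (D - 2) + 6) := ⟨_, rfl⟩
  rw [← hA, ← hB, ← hC] at key
  have hA0 : 0 ≤ A := by rw [hA]; exact mul_nonneg hM4.le (by linarith)
  have hB0 : 0 ≤ B := by rw [hB]; exact div_nonneg h4 (by linarith)
  have hpos : 0 < 2 / 3 * n * (D - 2) + 6 := by
    have := mul_nonneg (by linarith : 0 ≤ 2 / 3 * n) (by linarith : 0 ≤ D - 2)
    linarith
  have hC0 : 0 ≤ C := by rw [hC]; exact mul_nonneg (by linarith) hpos.le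
  refine ⟨sub_nonneg.mp (key ▸ div_nonneg (by linarith) hn0.le), ?_⟩
  rw [eq_comm, ← sub_eq_zero, key, div_eq_zero_iff, or_iff_left hn0.ne']
  constructor
  · intro h
    have hA1 : A = 0 := by linarith
    have hB1 : B = 0 := by linarith
    have hC1 : C = 0 := by linarith
    rw [hA, mul_eq_zero, or_iff_right hM4.ne'] at hA1
    rw [hB, div_eq_zero_iff, or_iff_left (by linarith)] at hB1
    rw [hC, mul_eq_zero, or_iff_left hpos.ne'] at hC1
    refine ⟨?_, ?_, ?_, ?_, ?_⟩ <;> linarith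
  · rintro ⟨e1, e2, e3, e4, e5⟩
    rw [hA, hB, hC, e1, e2, e3, e4, e5]
    ring

end Extremal

/-! ### The extremal tree described by a labelling. -/

section ForkLabel

variable {V : Type*} [Fintype V]

/-- `l` exhibits `T` as a path whose vertices carry the labels `0, …, n - 2` (with `u` the end
labelled `0`), and a further pendent vertex `v`, also labelled `0`, with the neighbour of `u`. -/
structure IsForkLabel (T : SimpleGraph V) (u v : V) (l : V → ℕ) : Prop where
  adj : ∀ x y, T.Adj x y ↔ l x + 1 = l y ∨ l y + 1 = l x
  left : l u = 0
  right : l v = 0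
  inj : ∀ x y, x ≠ v → y ≠ v → l x = l y → x = y
  lt : ∀ x, l x + 1 < Fintype.card V

/-- The potential vanishes at the midpoint `c 1` of `u` and `v`, hence at all vertices other than
`u`, `v`. These are then equidistant from `u` and `v`, and zero slack makes their mutual distances
differences of heights. The label is the height plus one. -/
theorem exists_isForkLabel [DecidableEq V] {T : SimpleGraph V} (hT : T.IsTree) {u v : V}
    (huv : u ≠ v) (hadj : ¬ T.Adj u v) (hD : T.dist u v = 2)
    (hφ : ∀ x ∈ univ \ {u, v}, ∀ y ∈ univ \ {u, v},
          potential (fun x y => (T.dist x y : ℝ)) u v x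
            = potential (fun x y => (T.dist x y : ℝ)) u v y)
    (hs : ∀ x y, slack T u v x y = 0) :
    ∃ l, IsForkLabel T u v l := by
  have hmem : ∀ x, x ∈ univ \ {u, v} ↔ x ≠ u ∧ x ≠ v := fun x => by simp
  obtain ⟨c, hc, -⟩ := exists_geodesic hT.connected u v
  have hc1 := hc 1 (by omega)
  have hcS : c 1 ∈ univ \ {u, v} := by
    rw [hmem]
    constructor
    · intro h; rw [h, SimpleGraph.dist_self] at hc1; omega
    · intro h; rw [h, SimpleGraph.dist_self] at hc1; omega
  have hd : ∀ x, x ≠ u → x ≠ v → T.dist u x = rho T u v x + 1 ∧ T.dist v x = rho T u v x + 1 := by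
    intro x hxu hxv
    have h1 := hφ x ((hmem x).mpr ⟨hxu, hxv⟩) (c 1) hcS
    have h2 : (T.dist (c 1) v : ℝ) = T.dist (c 1) u := by
      rw [T.dist_comm (v := u)]
      exact_mod_cast (by omega : T.dist (c 1) v = T.dist u (c 1))
    rw [potential, potential, h2, sub_self, zero_div, div_eq_zero_iff,
      or_iff_left two_ne_zero, sub_eq_zero] at h1
    have h3 : T.dist x v = T.dist x u := by exact_mod_cast h1
    have h4 := two_mul_rho hT u v x
    rw [T.dist_comm, T.dist_comm (u := x)] at h3
    omega
  have hdS : ∀ x y, x ≠ u → x ≠ v → y ≠ u → y ≠ v →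
      (T.dist x y : ℤ) = |(rho T u v x : ℤ) - rho T u v y| := by
    intro x y hxu hxv hyu hyv
    have h1 := hs x y
    rw [slack, hφ x ((hmem x).mpr ⟨hxu, hxv⟩) y ((hmem y).mpr ⟨hyu, hyv⟩), sub_self, abs_zero,
      sub_zero, sub_eq_zero] at h1
    exact_mod_cast h1
  have hadjS : ∀ x y, x ≠ u → x ≠ v → y ≠ u → y ≠ v →
      (T.Adj x y ↔ rho T u v x + 1 = rho T u v y ∨ rho T u v y + 1 = rho T u v x) := by
    intro x y hxu hxv hyu hyv
    rw [← SimpleGraph.dist_eq_one_iff_adj]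
    have := hdS x y hxu hxv hyu hyv
    rcases abs_cases ((rho T u v x : ℤ) - rho T u v y) with ⟨e, -⟩ | ⟨e, -⟩ <;>
      rw [e] at this <;> omega
  have hadju : ∀ y, y ≠ u → y ≠ v → (T.Adj u y ↔ rho T u v y = 0) := by
    intro y hyu hyv
    rw [← SimpleGraph.dist_eq_one_iff_adj, (hd y hyu hyv).1]; omega
  have hadjv : ∀ y, y ≠ u → y ≠ v → (T.Adj v y ↔ rho T u v y = 0) := by
    intro y hyu hyv
    rw [← SimpleGraph.dist_eq_one_iff_adj, (hd y hyu hyv).2]; omega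
  have hadj' : ¬ T.Adj v u := fun h => hadj h.symm
  have hlu : (fun x => if x = u ∨ x = v then 0 else rho T u v x + 1) u = 0 := by simp
  have hlv : (fun x => if x = u ∨ x = v then 0 else rho T u v x + 1) v = 0 := by simp
  have hlS : ∀ x, x ≠ u → x ≠ v →
      (fun x => if x = u ∨ x = v then 0 else rho T u v x + 1) x = rho T u v x + 1 := by
    intro x hxu hxv; simp [hxu, hxv]
  generalize (fun x => if x = u ∨ x = v then 0 else rho T u v x + 1) = l at *
  refine ⟨l, ?_, hlu, hlv, ?_, ?_⟩
  · intro x y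
    by_cases hxu : x = u
    · subst hxu
      by_cases hyu : y = x
      · subst hyu; simp
      by_cases hyv : y = v
      · subst hyv; simp [hadj, hlu, hlv]
      rw [hadju y hyu hyv, hlS y hyu hyv, hlu]; omega
    by_cases hxv : x = v
    · subst hxv
      by_cases hyv : y = x
      · subst hyv; simp
      by_cases hyu : y = u
      · subst hyu; simp [hadj', hlu, hlv]
      rw [hadjv y hyu hyv, hlS y hyu hyv, hlv]; omega
    rw [hlS x hxu hxv]
    by_cases hyu : y = u
    · subst hyu
      rw [T.adj_comm, hadju x hxu hxv, hlu]; omega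
    by_cases hyv : y = v
    · subst hyv
      rw [T.adj_comm, hadjv x hxu hxv, hlv]; omega
    rw [hadjS x y hxu hxv hyu hyv, hlS y hyu hyv]; omega
  · intro x y hxv hyv hxy
    by_cases hxu : x = u <;> by_cases hyu : y = u
    · rw [hxu, hyu]
    · rw [hxu, hlu, hlS y hyu hyv] at hxy; omega
    · rw [hyu, hlu, hlS x hxu hxv] at hxy; omega
    · rw [hlS x hxu hxv, hlS y hyu hyv] at hxy
      have h1 := hdS x y hxu hxv hyu hyv
      rw [Nat.succ_injective hxy, sub_self, abs_zero] at h1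
      exact hT.connected.dist_eq_zero_iff.mp (by exact_mod_cast h1)
  · intro x
    have hcard := card_sdiff_pair huv
    have hpos : 0 < #(univ \ {u, v} : Finset V) := card_pos.mpr ⟨_, hcS⟩
    by_cases hxu : x = u
    · rw [hxu, hlu]; omega
    by_cases hxv : x = v
    · rw [hxv, hlv]; omega
    rw [hlS x hxu hxv]
    -- Heights without gaps on `n - 2` vertices are at most `n - 3`.
    have : range (rho T u v x + 1) ⊆ (univ \ {u, v} : Finset V).image (rho T u v) := by
      intro a ha
      rw [mem_range] at ha
      obtain ⟨y, hyu, hyv, hy⟩ := exists_rho_eq hT huv hadj x a (by omega)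
      exact mem_image.mpr ⟨y, (hmem y).mpr ⟨hyu, hyv⟩, hy⟩
    have := (card_le_card this).trans card_image_le
    rw [card_range] at this
    omega

namespace IsForkLabel

variable {T : SimpleGraph V} {u v : V} {l : V → ℕ}

/-- Pigeonhole: the `n - 1` vertices other than `v` have distinct labels below `n - 1`. -/
theorem exists_eq (h : IsForkLabel T u v l) {k : ℕ} (hk : k + 1 < Fintype.card V) :
    ∃ x, x ≠ v ∧ l x = k := by
  classical
  have hmaps : Set.MapsTo l (univ.erase v : Finset V) (range (Fintype.card V - 1)) := by
    intro x _
    have := h.lt x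
    simp only [coe_range, Set.mem_Iio]; omega
  have hinj : Set.InjOn l (univ.erase v : Finset V) := by
    intro x hx y hy hxy
    simp only [coe_erase, coe_univ, Set.mem_sdiff, Set.mem_singleton_iff] at hx hy
    exact h.inj x y hx.2 hy.2 hxy
  have hsurj := surjOn_of_injOn_of_card_le l hmaps hinj (by simp [card_erase_of_mem])
  obtain ⟨x, hx, hxk⟩ := hsurj (show k ∈ ((range (Fintype.card V - 1) : Finset ℕ) : Set ℕ) by
    simp only [coe_range, Set.mem_Iio]; omega)
  exact ⟨x, by simpa using hx, hxk⟩

theorem eq_or_eq (h : IsForkLabel T u v l) (huv : u ≠ v) {x : V} (hx : l x = 0) :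
    x = u ∨ x = v := by
  by_cases hxv : x = v
  · exact Or.inr hxv
  · exact Or.inl (h.inj x u hxv huv (hx.trans h.left.symm))

theorem symm (h : IsForkLabel T u v l) (huv : u ≠ v) : IsForkLabel T v u l where
  adj := h.adj
  left := h.right
  right := h.left
  inj x y hx hy hxy := by
    by_cases hxv : x = v
    · rw [hxv, h.right] at hxy
      rcases h.eq_or_eq huv hxy.symm with hy' | hy'
      · exact absurd hy' hy
      · rw [hxv, hy']
    · by_cases hyv : y = v
      · rw [hyv, h.right] at hxy
        rcases h.eq_or_eq huv hxy with hx' | hx'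
        · exact absurd hx' hx
        · rw [hyv, hx']
      · exact h.inj x y hxv hyv hxy
  lt := h.lt

theorem le_dist (h : IsForkLabel T u v l) (hT : T.IsTree) (x y : V) :
    l y ≤ l x + T.dist x y := by
  obtain ⟨p, hp⟩ := hT.connected.exists_walk_length_eq_dist x y
  rw [← hp]
  clear hp
  induction p with
  | nil => simp
  | cons hab p ih =>
    have := (h.adj _ _).mp hab
    rw [SimpleGraph.Walk.length_cons]
    omega

theorem dist_le (h : IsForkLabel T u v l) (hT : T.IsTree) {x : V} (hx : x ≠ v) :
    ∀ k y, y ≠ v → l y = l x + k → T.dist x y ≤ k := by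
  intro k
  induction k with
  | zero =>
    intro y hy hxy
    rw [h.inj y x hy hx hxy, SimpleGraph.dist_self]
  | succ k ih =>
    intro y hy hxy
    have hlt := h.lt y
    obtain ⟨z, hz, hzk⟩ := h.exists_eq (k := l x + k) (by omega)
    have h1 := ih z hz hzk
    have h2 : T.dist z y = 1 :=
      SimpleGraph.dist_eq_one_iff_adj.mpr ((h.adj z y).mpr (Or.inl (by omega)))
    have h3 : T.dist x y ≤ T.dist x z + T.dist z y := hT.connected.dist_triangle
    omega

theorem dist_eq (h : IsForkLabel T u v l) (hT : T.IsTree) {x y : V} (hx : x ≠ v) (hy : y ≠ v) :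
    (T.dist x y : ℝ) = |(l x : ℝ) - l y| := by
  wlog hxy : l x ≤ l y generalizing x y
  · rw [SimpleGraph.dist_comm, abs_sub_comm]
    exact this hy hx (by omega)
  obtain ⟨k, hk⟩ := Nat.exists_eq_add_of_le hxy
  have h1 := h.dist_le hT hx k y hy hk
  have h2 := h.le_dist hT x y
  have h3 : T.dist x y = k := by omega
  rw [h3, hk]
  push_cast
  rw [abs_of_nonpos (by linarith [(Nat.cast_nonneg k : (0 : ℝ) ≤ k)])]
  ring

end IsForkLabel

end ForkLabel

/-! ### Labelled forks, paths with an added pendent vertex, and twins. -/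

section ForkIso

theorem addPendent_some_some {W : Type*} (H : SimpleGraph W) (a x y : W) :
    (addPendent H a).Adj (some x) (some y) ↔ H.Adj x y := by
  rw [addPendent, SimpleGraph.sup_adj, SimpleGraph.map_adj', SimpleGraph.edge_adj]
  constructor
  · rintro (⟨-, x', y', h, hx, hy⟩ | h)
    · rw [Option.some_inj] at hx hy
      rwa [← hx, ← hy]
    · simp at h
  · intro h
    exact Or.inl ⟨by simpa using h.ne, x, y, h, rfl, rfl⟩

theorem addPendent_none_some {W : Type*} (H : SimpleGraph W) (a x : W) :
    (addPendent H a).Adj none (some x) ↔ x = a := by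
  rw [addPendent, SimpleGraph.sup_adj, SimpleGraph.map_adj', SimpleGraph.edge_adj]
  simp

variable {V : Type*} [Fintype V] {T : SimpleGraph V} {u v : V} {l : V → ℕ}

namespace IsForkLabel

theorem exists_iso_addPendent (h : IsForkLabel T u v l) {m : ℕ} (hm : 3 ≤ m)
    (hV : Fintype.card V = m + 1) :
    ∃ a : Fin m, IsNextToPendent (SimpleGraph.pathGraph m) a ∧
      Nonempty (T ≃g addPendent (SimpleGraph.pathGraph m) a) := by
  classical
  have hlt : ∀ x, l x < m := fun x => by have := h.lt x; omega
  refine ⟨⟨1, by omega⟩, ⟨⟨0, by omega⟩, ⟨⟨1, by omega⟩, ?_, ?_⟩, ?_⟩, ?_⟩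
  · simp [SimpleGraph.pathGraph_adj]
  · intro y hy
    simp only [SimpleGraph.pathGraph_adj] at hy
    ext; simp only; omega
  · simp [SimpleGraph.pathGraph_adj]
  · obtain ⟨f, hf⟩ : ∃ f : V → Option (Fin m),
        f = fun x => if x = v then none else some ⟨l x, hlt x⟩ := ⟨_, rfl⟩
    have hfv : f v = none := by simp [hf]
    have hfS : ∀ x, x ≠ v → f x = some ⟨l x, hlt x⟩ := fun x hx => by simp [hf, hx]
    have hinj : Function.Injective f := by
      intro x y hxy
      by_cases hx : x = v <;> by_cases hy : y = v
      · rw [hx, hy]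
      · rw [hx, hfv, hfS y hy] at hxy; simp at hxy
      · rw [hy, hfv, hfS x hx] at hxy; simp at hxy
      · rw [hfS x hx, hfS y hy] at hxy
        exact h.inj x y hx hy (by simpa using hxy)
    have hbij : Function.Bijective f :=
      (Fintype.bijective_iff_injective_and_card f).mpr ⟨hinj, by simp [hV]⟩
    refine ⟨⟨Equiv.ofBijective f hbij, ?_⟩⟩
    intro x y
    simp only [Equiv.ofBijective_apply]
    rw [h.adj]
    by_cases hx : x = v <;> by_cases hy : y = v
    · rw [hx, hy]; simp
    · rw [hx, hfv, hfS y hy, addPendent_none_some, h.right, Fin.ext_iff]; simp only; omega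
    · rw [hy, hfv, hfS x hx, SimpleGraph.adj_comm, addPendent_none_some, h.right, Fin.ext_iff]
      simp only; omega
    · rw [hfS x hx, hfS y hy, addPendent_some_some, SimpleGraph.pathGraph_adj]

theorem areTwinPendent (h : IsForkLabel T u v l) (huv : u ≠ v) (hV : 4 ≤ Fintype.card V) :
    AreTwinPendent T u v := by
  obtain ⟨z, hz, hlz⟩ := h.exists_eq (k := 1) (by omega)
  have huz : T.Adj u z := (h.adj u z).mpr (by rw [h.left]; omega)
  have hvz : T.Adj v z := (h.adj v z).mpr (by rw [h.right]; omega)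
  have huniq : ∀ y, l y = 1 → y = z := fun y hy =>
    h.inj y z (fun e => by rw [e, h.right] at hy; omega) hz (by omega)
  refine ⟨huv, ⟨z, huz, fun y hy => huniq y ?_⟩, ⟨z, hvz, fun y hy => huniq y ?_⟩, z, huz, hvz⟩
  · have := (h.adj u y).mp hy
    rw [h.left] at this; omega
  · have := (h.adj v y).mp hy
    rw [h.right] at this; omega

theorem eq_zero_or_eq_of_isPendent (h : IsForkLabel T u v l) {x : V} (hx : IsPendent T x) :
    l x = 0 ∨ l x + 2 = Fintype.card V := by
  by_contra hne
  have hlt := h.lt x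
  obtain ⟨y, -, hy⟩ := h.exists_eq (k := l x - 1) (by omega)
  obtain ⟨z, -, hz⟩ := h.exists_eq (k := l x + 1) (by omega)
  have hxy := (h.adj x y).mpr (by omega)
  have hxz := (h.adj x z).mpr (by omega)
  have := hx.unique hxy hxz
  rw [this] at hy
  omega

/-- In the fork with four vertices, which is a star, any two leaves may be put at the labels `0`. -/
theorem exists_of_card_eq_four (h : IsForkLabel T u v l) (huv : u ≠ v)
    (hV : Fintype.card V = 4) {x y : V} (hxy : x ≠ y) (hx : l x = 0) (hy : l y = 2) :
    ∃ l', IsForkLabel T x y l' := by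
  classical
  have hlt : ∀ z, l z ≤ 2 := fun z => by have := h.lt z; omega
  -- The centre keeps label `1`, the chosen leaves get `0`, and the third leaf gets `2`.
  obtain ⟨l', hl'⟩ : ∃ l' : V → ℕ, l' = fun z => if l z = 1 then 1 else
    if z = x ∨ z = y then 0 else 2 := ⟨_, rfl⟩
  have h1 : ∀ z, l' z = 1 ↔ l z = 1 := fun z => by
    rw [hl']; dsimp only; split_ifs <;> simp_all
  have h0 : ∀ z, l' z = 0 ↔ z = x ∨ z = y := fun z => by
    rw [hl']; dsimp only
    split_ifs with e1 e2
    · simp only [false_iff]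
      rintro (rfl | rfl) <;> omega
    · simpa using e2
    · simpa using e2
  have h2 : ∀ z, l' z ≤ 2 := fun z => by
    rw [hl']; dsimp only; split_ifs <;> omega
  refine ⟨l', fun a b => ?_, (h0 x).mpr (Or.inl rfl), (h0 y).mpr (Or.inr rfl), ?_, fun z => ?_⟩
  · rw [h.adj]
    have := h1 a; have := h1 b; have := h2 a; have := h2 b; have := hlt a; have := hlt b
    omega
  · intro a b ha hb hab
    by_cases e1 : l a = 1
    · have e2 : l b = 1 := by rw [← h1, ← hab, h1]; exact e1
      exact h.inj a b (fun e => by rw [e, h.right] at e1; omega)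
        (fun e => by rw [e, h.right] at e2; omega) (by omega)
    by_cases e0 : l' a = 0
    · have e0' : l' b = 0 := hab ▸ e0
      rw [((h0 a).mp e0).resolve_right ha, ((h0 b).mp e0').resolve_right hb]
    have e0' : l' b ≠ 0 := hab ▸ e0
    have e1' : l b ≠ 1 := by rw [Ne, ← h1, ← hab, h1]; exact e1
    rw [Ne, h0, not_or] at e0'
    rw [h0, not_or] at e0
    have hz : ∀ z, z ≠ y → l z ≠ 1 → l z = 0 := by
      intro z hzy hz1
      by_contra hz0
      have := hlt z
      exact hzy (h.inj z y (fun e => by rw [e, h.right] at hz0; omega)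
        (fun e => by rw [e, h.right] at hy; omega) (by omega))
    have ha' := h.eq_or_eq huv (hz a ha e1)
    have hb' := h.eq_or_eq huv (hz b hb e1')
    have hx' := h.eq_or_eq huv hx
    rcases ha' with rfl | rfl <;> rcases hb' with rfl | rfl <;> rcases hx' with rfl | rfl <;>
      first | rfl | exact absurd rfl e0.1 | exact absurd rfl e0'.1
  · have := h2 z; omega

/-- Pendent vertices have label `0` or `n - 2`, and a common neighbour makes the labels of twins
equal or two apart. So the twins are the pair labelled `0`, unless `n = 4`, where any two leaves of
the star are twins. -/
theorem exists_of_areTwinPendent (h : IsForkLabel T u v l) (huv : u ≠ v)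
    (hV : 4 ≤ Fintype.card V) {x y : V} (hxy : AreTwinPendent T x y) :
    ∃ l', IsForkLabel T x y l' := by
  obtain ⟨hne, hx, hy, z, hxz, hyz⟩ := hxy
  have hx' := h.eq_zero_or_eq_of_isPendent hx
  have hy' := h.eq_zero_or_eq_of_isPendent hy
  have hxz' := (h.adj x z).mp hxz
  have hyz' := (h.adj y z).mp hyz
  by_cases hx0 : l x = 0 <;> by_cases hy0 : l y = 0
  · rcases h.eq_or_eq huv hx0 with rfl | rfl <;> rcases h.eq_or_eq huv hy0 with rfl | rfl
    · exact absurd rfl hne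
    · exact ⟨l, h⟩
    · exact ⟨l, h.symm huv⟩
    · exact absurd rfl hne
  · exact h.exists_of_card_eq_four huv (by omega) hne hx0 (by omega)
  · obtain ⟨l', hl'⟩ := h.exists_of_card_eq_four huv (by omega) hne.symm hy0 (by omega)
    exact ⟨l', hl'.symm hne.symm⟩
  · exact absurd (h.inj x y (fun e => hx0 (e ▸ h.right)) (fun e => hy0 (e ▸ h.right)) (by omega))
      hne

end IsForkLabel

theorem exists_isForkLabel_of_iso {m : ℕ} (hm : 3 ≤ m) (hV : Fintype.card V = m + 1) {a : Fin m}
    (ha : IsNextToPendent (SimpleGraph.pathGraph m) a)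
    (e : T ≃g addPendent (SimpleGraph.pathGraph m) a) :
    ∃ w₁ w₀ l, w₁ ≠ w₀ ∧ IsForkLabel T w₁ w₀ l := by
  obtain ⟨x, hx, hxa⟩ := ha
  have hxm := x.2
  have ham := a.2
  have hx0 : x.val = 0 ∨ x.val + 1 = m := by
    by_contra hne
    have h1 : (SimpleGraph.pathGraph m).Adj x ⟨x.val - 1, by omega⟩ := by
      rw [SimpleGraph.pathGraph_adj]; simp only; omega
    have h2 : (SimpleGraph.pathGraph m).Adj x ⟨x.val + 1, by omega⟩ := by
      rw [SimpleGraph.pathGraph_adj]; exact Or.inl rfl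
    have := hx.unique h1 h2
    rw [Fin.mk.injEq] at this
    omega
  rw [SimpleGraph.pathGraph_adj] at hxa
  -- The position on the path counted from its end `x`, reversed if `x` is the last vertex.
  obtain ⟨r, hr0, hrinj, hra, hradj, hrlt⟩ : ∃ r : Fin m → ℕ, r x = 0 ∧ Function.Injective r ∧
      r a = 1 ∧ (∀ i j, (SimpleGraph.pathGraph m).Adj i j ↔ r i + 1 = r j ∨ r j + 1 = r i) ∧
      ∀ i, r i < m := by
    rcases hx0 with hx0 | hx0
    · exact ⟨fun i => i.val, hx0, Fin.val_injective, by beta_reduce; omega,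
        fun i j => SimpleGraph.pathGraph_adj, fun i => i.2⟩
    · refine ⟨fun i => m - 1 - i.val, by beta_reduce; omega, fun i j hij => ?_,
        by beta_reduce; omega, fun i j => ?_, fun i => by beta_reduce; omega⟩
      · have hi := i.2
        have hj := j.2
        ext; simp only at hij; omega
      · have hi := i.2
        have hj := j.2
        rw [SimpleGraph.pathGraph_adj]; beta_reduce; omega
  obtain ⟨q, hqn, hqs⟩ : ∃ q : Option (Fin m) → ℕ, q none = 0 ∧ ∀ i, q (some i) = r i :=
    ⟨fun o => o.elim 0 r, rfl, fun _ => rfl⟩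
  refine ⟨e.symm (some x), e.symm none, fun y => q (e y), ?_, ?_, ?_, ?_, ?_, ?_⟩
  · intro h
    have := e.symm.injective h
    simp at this
  · intro y z
    rw [← e.map_adj_iff]
    rcases hy : e y with _ | i <;> rcases hz : e z with _ | j
    · simp [hqn]
    · rw [addPendent_none_some, hqn, hqs, ← hrinj.eq_iff, hra]; omega
    · rw [SimpleGraph.adj_comm, addPendent_none_some, hqn, hqs, ← hrinj.eq_iff, hra]; omega
    · rw [addPendent_some_some, hqs, hqs, hradj]
  · simp [hqs, hr0]
  · simp [hqn]
  · intro y z hyn hzn hyz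
    apply e.injective
    rcases hy : e y with _ | i
    · exact absurd (by rw [← hy]; simp) hyn
    rcases hz : e z with _ | j
    · exact absurd (by rw [← hz]; simp) hzn
    rw [hy, hz, hqs, hqs] at hyz
    rw [hrinj hyz]
  · intro y
    rw [hV]
    rcases hy : e y with _ | i
    · simp only [hqn]; omega
    · have := hrlt i
      simp only [hqs]; omega

end ForkIso

/-! ### The fork attains equality. -/

section ForkEquality

variable {V : Type*} [Fintype V] {T : SimpleGraph V} {u v : V} {l : V → ℕ}

namespace IsForkLabel

theorem dist_pair (h : IsForkLabel T u v l) (hT : T.IsTree) (huv : u ≠ v)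
    (hV : 4 ≤ Fintype.card V) : T.dist u v = 2 := by
  obtain ⟨z, -, hz⟩ := h.exists_eq (k := 1) (by omega)
  have huz : T.dist u z = 1 :=
    SimpleGraph.dist_eq_one_iff_adj.mpr ((h.adj u z).mpr (by rw [h.left]; omega))
  have hzv : T.dist z v = 1 :=
    SimpleGraph.dist_eq_one_iff_adj.mpr ((h.adj z v).mpr (by rw [h.right]; omega))
  have h1 : T.dist u v ≤ T.dist u z + T.dist z v := hT.connected.dist_triangle
  have h2 := hT.connected.one_lt_dist_of_ne_of_not_adj huv (fun hadj => by
    have := (h.adj u v).mp hadj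
    rw [h.left, h.right] at this; omega)
  omega

theorem dist_left (h : IsForkLabel T u v l) (hT : T.IsTree) (huv : u ≠ v) {x : V} (hx : x ≠ v) :
    T.dist u x = l x := by
  have h1 := h.dist_eq hT huv hx
  rw [h.left, abs_sub_comm] at h1
  simpa using h1

theorem deg_left [DecidableEq V] (h : IsForkLabel T u v l) (hV : 4 ≤ Fintype.card V) :
    deg T u = 1 := by
  obtain ⟨z, hz, hlz⟩ := h.exists_eq (k := 1) (by omega)
  rw [deg_eq_sum, sum_eq_single z]
  · rw [if_pos ((h.adj u z).mpr (by rw [h.left]; omega))]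
  · intro y _ hy
    rw [if_neg]
    intro hadj
    have := (h.adj u y).mp hadj
    rw [h.left] at this
    exact hy (h.inj y z (fun e => by rw [e, h.right] at this; omega) hz (by omega))
  · simp

/-- The heights run once through `0, …, n - 3`, and the potential is `1` at `u`, `-1` at `v` and `0`
elsewhere. As `u` and `v` have degree two in the new graph, the energy is `16 n`. -/
theorem extremal [DecidableEq V] (h : IsForkLabel T u v l) (hT : T.IsTree) (huv : u ≠ v)
    (hadj : ¬ T.Adj u v) (hV : 4 ≤ Fintype.card V) {n : ℝ} (hn : n = Fintype.card V) :
    ∑ x ∈ univ \ {u, v}, ∑ y ∈ univ \ {u, v}, (min (rho T u v x) (rho T u v y) : ℝ)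
          - ∑ x ∈ univ \ {u, v}, (rho T u v x : ℝ) = (n - 2) * (n - 3) * (n - 4) / 3 ∧
      (∀ x ∈ univ \ {u, v}, ∀ y ∈ univ \ {u, v},
          potential (fun x y => (T.dist x y : ℝ)) u v x
            = potential (fun x y => (T.dist x y : ℝ)) u v y) ∧
      (∀ x y, slack T u v x y = 0) ∧
      energy T u v = 2 / 3 * n * (T.dist u v : ℝ) * ((T.dist u v : ℝ) + 1)
          * ((T.dist u v : ℝ) + 2) ∧
      T.dist u v = 2 := by
  have hD := h.dist_pair hT huv hV
  have hmem : ∀ x, x ∈ univ \ {u, v} ↔ x ≠ u ∧ x ≠ v := fun x => by simp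
  have hdv : ∀ x, x ≠ u → T.dist v x = l x := fun x hx =>
    (h.symm huv).dist_left hT huv.symm hx
  have hpos : ∀ x, x ≠ u → x ≠ v → 1 ≤ l x := by
    intro x hxu hxv
    by_contra hlt
    rcases h.eq_or_eq huv (by omega : l x = 0) with hx | hx
    · exact hxu hx
    · exact hxv hx
  have hρ : ∀ x, x ≠ u → x ≠ v → rho T u v x + 1 = l x := by
    intro x hxu hxv
    have h1 := two_mul_rho hT u v x
    rw [hD, h.dist_left hT huv hxv, hdv x hxu] at h1
    omega
  have hφu : potential (fun x y => (T.dist x y : ℝ)) u v u = 1 := by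
    simp [potential, hD]
  have hφv : potential (fun x y => (T.dist x y : ℝ)) u v v = -1 := by
    simp [potential, T.dist_comm (u := v) (v := u), hD]
  have hφ : ∀ x, x ≠ u → x ≠ v → potential (fun x y => (T.dist x y : ℝ)) u v x = 0 := by
    intro x hxu hxv
    simp [potential, T.dist_comm (u := x), h.dist_left hT huv hxv, hdv x hxu]
  refine ⟨?_, ?_, ?_, ?_, hD⟩
  · have hcard := card_sdiff_pair huv
    obtain ⟨m, hm⟩ : ∃ m, m = #(univ \ {u, v} : Finset V) := ⟨_, rfl⟩
    have hmaps : Set.MapsTo (rho T u v) (univ \ {u, v} : Finset V) (range m) := by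
      intro x hx
      rw [mem_coe, hmem] at hx
      have h1 := hρ x hx.1 hx.2
      have h2 := h.lt x
      rw [mem_coe, mem_range]; omega
    have hinj : Set.InjOn (rho T u v) (univ \ {u, v} : Finset V) := by
      intro x hx y hy hxy
      rw [mem_coe, hmem] at hx hy
      exact h.inj x y hx.2 hy.2 (by rw [← hρ x hx.1 hx.2, ← hρ y hy.1 hy.2, hxy])
    have hbij : Set.BijOn (rho T u v) (univ \ {u, v} : Finset V) (range m) :=
      ⟨hmaps, hinj, surjOn_of_injOn_of_card_le _ hmaps hinj (by rw [card_range, hm])⟩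
    rw [sum_min_eq_of_bijOn _ _ m hbij]
    have : (m : ℝ) = n - 2 := by rw [hn, ← hcard, hm]; push_cast; ring
    rw [this]; ring
  · intro x hx y hy
    rw [hmem] at hx hy
    rw [hφ x hx.1 hx.2, hφ y hy.1 hy.2]
  · have hsymm : ∀ x y, slack T u v x y = slack T u v y x := fun x y => by
      rw [slack, slack, SimpleGraph.dist_comm, abs_sub_comm, abs_sub_comm (potential _ u v y)]
    have hself : ∀ x, slack T u v x x = 0 := fun x => by simp [slack]
    have hSu : ∀ y, y ≠ u → y ≠ v → slack T u v u y = 0 := by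
      intro y hyu hyv
      have h1 : (rho T u v y : ℝ) + 1 = l y := by exact_mod_cast hρ y hyu hyv
      rw [slack, rho_left, hφu, hφ y hyu hyv, h.dist_left hT huv hyv, ← h1]
      simp
    have hSv : ∀ y, y ≠ u → y ≠ v → slack T u v v y = 0 := by
      intro y hyu hyv
      have h1 : (rho T u v y : ℝ) + 1 = l y := by exact_mod_cast hρ y hyu hyv
      rw [slack, rho_right, hφv, hφ y hyu hyv, hdv y hyu, ← h1]
      simp
    have hSuv : slack T u v u v = 0 := by
      rw [slack, rho_left, rho_right, hφu, hφv, hD]; norm_num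
    intro x y
    by_cases hxu : x = u
    · subst hxu
      by_cases hyu : y = x
      · rw [hyu, hself]
      by_cases hyv : y = v
      · rw [hyv, hSuv]
      exact hSu y hyu hyv
    by_cases hxv : x = v
    · subst hxv
      by_cases hyv : y = x
      · rw [hyv, hself]
      by_cases hyu : y = u
      · rw [hyu, hsymm, hSuv]
      exact hSv y hyu hyv
    by_cases hyu : y = u
    · rw [hyu, hsymm, hSu x hxu hxv]
    by_cases hyv : y = v
    · rw [hyv, hsymm, hSv x hxu hxv]
    rw [slack, hφ x hxu hxv, hφ y hyu hyv, h.dist_eq hT hxv hyv, ← hρ x hxu hxv, ← hρ y hyu hyv]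
    simp
  · have hdu := h.deg_left hV
    have hdv' := (h.symm huv).deg_left hV
    have hw : ∑ x, deg (T ⊔ SimpleGraph.edge u v) x = 2 * n := by
      have := sum_deg_sup_edge_mul huv hadj (fun _ => 1)
      simp only [mul_one, sum_deg hT, ← hn] at this
      linarith
    have hz : ∀ g : ℝ → ℝ, g 0 = 0 → ∑ x ∈ univ \ {u, v}, deg (T ⊔ SimpleGraph.edge u v) x *
        g (potential (fun x y => (T.dist x y : ℝ)) u v x) = 0 := fun g hg =>
      sum_eq_zero fun x hx => by
        rw [hmem] at hx
        rw [hφ x hx.1 hx.2, hg, mul_zero]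
    have h1 := hz (fun t => t) rfl
    have h2 := hz (fun t => t ^ 2) (by norm_num)
    rw [energy, sum_sum_mul_sub_sq, hw,
      sum_eq_add_add_sum_sdiff huv (fun x => _ * potential _ u v x ^ 2), h2,
      sum_eq_add_add_sum_sdiff huv (fun x => _ * potential _ u v x), h1, hφu, hφv,
      deg_sup_edge huv hadj, deg_sup_edge huv hadj, hdu, hdv', hD]
    simp [huv, huv.symm]
    ring

end IsForkLabel

end ForkEquality

/-! ### Asymptotics of the bound. -/

section Asymptotics

theorem bound_isEquivalent : Asymptotics.IsEquivalent Filter.atTop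
      (fun m : ℕ => (4 * (m : ℝ) ^ 3 - 32 * (m : ℝ) ^ 2 + 85 * (m : ℝ) - 81)
        / (6 * (m : ℝ) * ((m : ℝ) - 1)))
      (fun m : ℕ => 2 * (m : ℝ) / 3) := by
  have hinv : Filter.Tendsto (fun m : ℕ => ((m : ℝ))⁻¹) Filter.atTop (nhds 0) :=
    tendsto_inv_atTop_nhds_zero_nat
  apply Asymptotics.isEquivalent_of_tendsto_one
  -- The quotient by `2m/3`, written in powers of `1/m`.
  have h : Filter.Tendsto (fun m : ℕ => (4 - 32 * ((m : ℝ))⁻¹ + 85 * ((m : ℝ))⁻¹ ^ 2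
      - 81 * ((m : ℝ))⁻¹ ^ 3) / (4 * (1 - ((m : ℝ))⁻¹))) Filter.atTop
      (nhds ((4 - 32 * 0 + 85 * 0 ^ 2 - 81 * 0 ^ 3) / (4 * (1 - 0)))) := by
    refine Filter.Tendsto.div ?_ ?_ (by norm_num)
    · exact (((hinv.const_mul 32).const_sub 4).add ((hinv.pow 2).const_mul 85)).sub
        ((hinv.pow 3).const_mul 81)
    · exact (hinv.const_sub 1).const_mul 4
  norm_num at h
  refine h.congr' ?_
  filter_upwards [Filter.eventually_gt_atTop 1] with m hm
  have h1 : (1 : ℝ) < m := by exact_mod_cast hm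
  have h2 : (m : ℝ) - 1 ≠ 0 := by linarith
  have h3 : (m : ℝ) ≠ 0 := by linarith
  have h4 : 1 - ((m : ℝ))⁻¹ ≠ 0 := by
    rw [show 1 - ((m : ℝ))⁻¹ = ((m : ℝ) - 1) / m by field_simp]
    exact div_ne_zero h2 h3
  simp only [Pi.div_apply]
  field_simp
  ring

end Asymptotics

end KemenyTree

theorem corollary3p3 {V : Type*} [Fintype V] (n : ℕ) (hn : 4 ≤ n) (hV : Fintype.card V = n)
    (T : SimpleGraph V) (hT : T.IsTree) (u v : V) (huv : u ≠ v) (hadj : ¬ T.Adj u v)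
    (i j : V) :
    KemenyTree.kemeny (T ⊔ SimpleGraph.edge u v) i - KemenyTree.kemeny T j
        ≤ (4 * (n : ℝ) ^ 3 - 32 * (n : ℝ) ^ 2 + 85 * (n : ℝ) - 81) / (6 * (n : ℝ) * ((n : ℝ) - 1)) ∧
    (KemenyTree.kemeny (T ⊔ SimpleGraph.edge u v) i - KemenyTree.kemeny T j
        = (4 * (n : ℝ) ^ 3 - 32 * (n : ℝ) ^ 2 + 85 * (n : ℝ) - 81) / (6 * (n : ℝ) * ((n : ℝ) - 1)) ↔
      (∃ a : Fin (n - 1), KemenyTree.IsNextToPendent (SimpleGraph.pathGraph (n - 1)) a ∧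
        Nonempty (T ≃g KemenyTree.addPendent (SimpleGraph.pathGraph (n - 1)) a)) ∧
      KemenyTree.AreTwinPendent T u v) ∧
    Asymptotics.IsEquivalent Filter.atTop
      (fun m : ℕ => (4 * (m : ℝ) ^ 3 - 32 * (m : ℝ) ^ 2 + 85 * (m : ℝ) - 81)
        / (6 * (m : ℝ) * ((m : ℝ) - 1)))
      (fun m : ℕ => 2 * (m : ℝ) / 3) := by
  classical
  have : Nontrivial V := ⟨u, v, huv⟩
  have hn' : (n : ℝ) = Fintype.card V := by rw [hV]
  have hV4 : 4 ≤ Fintype.card V := hV ▸ hn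
  have hV1 : Fintype.card V = (n - 1) + 1 := by omega
  obtain ⟨hle, heq⟩ := KemenyTree.kemeny_sub_le_and_eq_iff hT huv hadj i j hn'
  refine ⟨hle, heq.trans ⟨?_, ?_⟩, KemenyTree.bound_isEquivalent⟩
  -- Constant potential, zero slack and `D = 2` already determine the tree.
  · rintro ⟨-, hφ, hs, -, hD⟩
    obtain ⟨l, hl⟩ := KemenyTree.exists_isForkLabel hT huv hadj hD hφ hs
    exact ⟨hl.exists_iso_addPendent (by omega) hV1, hl.areTwinPendent huv hV4⟩
  · rintro ⟨⟨a, ha, ⟨e⟩⟩, htwin⟩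
    -- The isomorphism labels some pair `w₁`, `w₀` by `0`; the labelling is then moved to the given
    -- twins `u`, `v`.
    obtain ⟨w₁, w₀, l, hw, hl⟩ := KemenyTree.exists_isForkLabel_of_iso (by omega) hV1 ha e
    obtain ⟨l', hl'⟩ := hl.exists_of_areTwinPendent hw hV4 htwin
    exact hl'.extremal hT huv hadj hV4 hn'
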